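/- Let $a,b>0$ and $S^1=\mathbb{R}/\mathbb{Z}$. Let $\mathrm{Diff}(S^1)$ be the group of orientation preserving smooth diffeomorphisms of $S^1$ with its Fréchet manifold structure (so $T_\eta\mathrm{Diff}(S^1)=\{u\circ\eta : u\in C^\infty(S^1)\}$), and let $G=\mathrm{Diff}(S^1)\ltimes C^\infty(S^1)$ be the semidirect product with group law $(\eta,F)\cdot(\xi,H)=(\eta\circ\xi,\,F\circ\xi+H)$. Give $\mathrm{Diff}(S^1)$ the right-invariant $a$-$b$ metric, equal to $\langle\!\langle u,v\rangle\!\rangle=\int_{S^1}(auv+bu_xv_x)\,dx$ at the identity, and give $G$ the right-invariant metric equal to $\langle\!\langle (u,f),(v,g)\rangle\!\rangle=\int_{S^1}(auv+bfg)\,dx$ at the identity. Let $\Upsilon\colon\mathrm{Diff}(S^1)\to G$, $\Upsilon(\eta)=(\eta,\ln\eta_x)$. Then: 1. $\Upsilon$ is a group homomorphism and a smooth embedding (a smooth immersion, with complemented tangent spaces, that is a homeomorphism onto its image), with $D\Upsilon_\eta(u\circ\eta)=(u\circ\eta,\,u_x\circ\eta)$. 2. The metric induced on $\mathrm{Diff}(S^1)$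 by $\Upsilon$ from the metric of $G$ is the $a$-$b$ metric. 3. Let $A=a-b\,\partial_x^2$, which is bijective on $C^\infty(S^1)$, and $Q(u,v)=-\partial_x^2A^{-1}\big(auv+\tfrac b2u_xv_x\big)$. Both metrics have Levi-Civita connections, whose curvature tensors $R$ (of $\mathrm{Diff}(S^1)$) and $\bar R$ (of $G$) exist. The second fundamental form $\Pi$ of $\Upsilon$ is normal to the image and is given at the identity by $\Pi(u,v)=\big(\tfrac ba\,Q(u,v)_x,\;Q(u,v)\big)$, and, right-invariantly, at every $\eta$. The Gauss–Codazzi formula $$\langle\!\langle R(U,V)V,U\rangle\!\rangle=\langle\!\langle \bar R(D\Upsilon U,D\Upsilon V)D\Upsilon V,D\Upsilon U\rangle\!\rangle+\langle\!\langle\Pi(U,U),\Pi(V,V)\rangle\!\rangle-\langle\!\langle\Pi(U,V),\Pi(U,V)\rangle\!\rangle$$ holds, and for $U=u\circ\eta$, $V=v\circ\eta$ it is, term by term, the curvature formula $$S(u,v)=\tfrac1a\int_{S^1}\Big(a(uv_x-vu_x)+\tfrac b2(v_xu_{xx}-u_xv_{xx})\Big)^2dx+\tfrac ba\langle\!\langle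 Q(u,u),Q(v,v)\rangle\!\rangle-\tfrac ba\langle\!\langle Q(u,v),Q(u,v)\rangle\!\rangle,$$ where $S(u,v)=\langle\!\langle R(u,v)v,u\rangle\!\rangle$ and the inner products on the right-hand side are $\int_{S^1}(a\,\cdot\,\cdot+b\,\partial_x\cdot\,\partial_x\cdot)\,dx$. -/

import Mathlib

open Filter Topology Set
open scoped ContDiff

namespace CircleGeometry

/-! ## Differential calculus in topological vector spaces -/

/-- The curve `c` in a topological vector space has velocity `v` at time `0`:
`(c t - c 0) / t → v` as `t → 0`, `t ≠ 0`. -/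
def HasVelocity {F : Type} [AddCommGroup F] [Module ℝ F] [TopologicalSpace F]
    (c : ℝ → F) (v : F) : Prop :=
  Tendsto (fun t : ℝ => t⁻¹ • (c t - c 0)) (𝓝[≠] 0) (𝓝 v)

/-- `f` is of class `C^k` on the (open) set `s` in the sense of Michal and Bastiani: `f` is
continuous and, if `k ≥ 1`, all its directional derivatives `df (x, v)` exist and
`df : s × E → F` is of class `C^(k-1)`. -/
def IsBastianiOn : ℕ → ∀ {E F : Type} [AddCommGroup E] [Module ℝ E] [TopologicalSpace E]
    [AddCommGroup F] [Module ℝ F] [TopologicalSpace F], (E → F) → Set E → Prop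
  | 0, _, _, _, _, _, _, _, _, f, s => ContinuousOn f s
  | k + 1, E, F, _, _, _, _, _, _, f, s =>
      ContinuousOn f s ∧ ∃ df : E × E → F,
        (∀ x ∈ s, ∀ v : E, HasVelocity (fun t : ℝ => f (x + t • v)) (df (x, v))) ∧
        IsBastianiOn k df (s ×ˢ univ)

/-- `f` is of class `C^∞` on the (open) set `s`. -/
def IsSmoothOn {E F : Type} [AddCommGroup E] [Module ℝ E] [TopologicalSpace E]
    [AddCommGroup F] [Module ℝ F] [TopologicalSpace F] (f : E → F) (s : Set E) : Prop :=
  ∀ k : ℕ, IsBastianiOn k f s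

/-! ## Manifolds with translation charts

The manifolds below (`Diff(S¹)` and the semidirect product) are modelled on a Fréchet space `E`
and are covered by the local parametrizations `v ↦ τ p v` ("`p + v`"), defined for `v` near `0`,
one for each point `p`. The changes of charts are translations, so that every tangent space is
canonically identified with `E`, the vector `v` being the velocity of `t ↦ τ p (t • v)` at `p`. -/

section Manifold

variable {M M' E E' : Type}
  [AddCommGroup E] [Module ℝ E] [TopologicalSpace E]
  [AddCommGroup E'] [Module ℝ E'] [TopologicalSpace E']

/-- `F` is a smooth expression, on the open neighbourhood `U` of `0`, of the map `f : M → M'` in the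
charts at `p` and at `f p`. -/
def IsLocalRep (τ : M → E → M) (τ' : M' → E' → M') (f : M → M') (p : M)
    (U : Set E) (F : E → E') : Prop :=
  IsOpen U ∧ (0 : E) ∈ U ∧ F 0 = 0 ∧ IsSmoothOn F U ∧ ∀ v ∈ U, f (τ p v) = τ' (f p) (F v)

/-- `f` is smooth near `p` and `L` is its tangent map at `p`. -/
def HasTangentMapAt (τ : M → E → M) (τ' : M' → E' → M') (f : M → M') (p : M)
    (L : E →L[ℝ] E') : Prop :=
  ∃ (U : Set E) (F : E → E'), IsLocalRep τ τ' f p U F ∧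
    ∀ v : E, HasVelocity (fun t : ℝ => F (t • v)) (L v)

/-- `f` is a smooth immersion at `p`: after composition with a local diffeomorphism `Φ` of `E'`
fixing `0`, its expression `F` in charts becomes a continuous linear map `L` with a continuous
linear left inverse (the inclusion of a complemented subspace). -/
def IsImmersionAt (τ : M → E → M) (τ' : M' → E' → M') (f : M → M') (p : M) : Prop :=
  ∃ (U : Set E) (F : E → E'), IsLocalRep τ τ' f p U F ∧
    ∃ Φ : OpenPartialHomeomorph E' E', (0 : E') ∈ Φ.source ∧ Φ 0 = 0 ∧
      IsSmoothOn Φ Φ.source ∧ IsSmoothOn Φ.symm Φ.target ∧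
      ∃ (L : E →L[ℝ] E') (P : E' →L[ℝ] E), (∀ v, P (L v) = v) ∧
        ∀ v ∈ U, F v ∈ Φ.source ∧ Φ (F v) = L v

/-- `f` is a smooth embedding: a smooth immersion that is a homeomorphism onto its image. -/
def IsSmoothEmbedding [TopologicalSpace M] [TopologicalSpace M']
    (τ : M → E → M) (τ' : M' → E' → M') (f : M → M') : Prop :=
  IsEmbedding f ∧ ∀ p, IsImmersionAt τ τ' f p

/-- The connection `∇_X Y = D_X Y + Γ(X, Y)`, given by its Christoffel map `Γ` in the translation
charts, is the Levi-Civita connection of the (weak) Riemannian metric `g`: it is torsion-free,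
and it is compatible with the metric, `D_U (g(V, W)) = g(∇_U V, W) + g(V, ∇_U W)`, tested on
vector fields `V`, `W` that are constant in the chart. -/
def IsLeviCivita (τ : M → E → M) (g : M → E → E → ℝ) (Γ : M → E →ₗ[ℝ] E →ₗ[ℝ] E) : Prop :=
  (∀ p U V, Γ p U V = Γ p V U) ∧
  ∀ p U V W, HasDerivAt (fun t : ℝ => g (τ p (t • U)) V W)
    (g p (Γ p U V) W + g p V (Γ p U W)) 0

/-- `R` is the value `R(U, V) W` at `p` of the curvature tensor
`R(U, V) W = ∇_U ∇_V W - ∇_V ∇_U W - ∇_[U,V] W` of the connection with Christoffel map `Γ`,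
evaluated on vector fields that are constant in the chart (so that `[U, V] = 0`). -/
def HasCurvatureAt (τ : M → E → M) (Γ : M → E →ₗ[ℝ] E →ₗ[ℝ] E) (p : M) (U V W R : E) : Prop :=
  ∃ D₁ D₂ : E,
    HasVelocity (fun t : ℝ => Γ (τ p (t • U)) V W) D₁ ∧
    HasVelocity (fun t : ℝ => Γ (τ p (t • V)) U W) D₂ ∧
    R = (D₁ + Γ p U (Γ p V W)) - (D₂ + Γ p V (Γ p U W))

/-- `B` is the value `Π(U, V) = ∇'_U V - ∇_U V` at `p` of the second fundamental form of the
embedding `f : M → M'` with tangent maps `df`. Here `V` is constant in the chart of `M`; the ambient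
derivative `∇'_U V` is that of the field `df V` along `f`, and `∇_U V` is pushed forward by `df`. -/
def HasSecondFundamentalFormAt (τ : M → E → M) (f : M → M') (df : M → E →L[ℝ] E')
    (Γ : M → E →ₗ[ℝ] E →ₗ[ℝ] E) (Γ' : M' → E' →ₗ[ℝ] E' →ₗ[ℝ] E') (p : M) (U V : E) (B : E') :
    Prop :=
  ∃ D : E', HasVelocity (fun t : ℝ => df (τ p (t • U)) V) D ∧
    B = (D + Γ' (f p) (df p U) (df p V)) - df p (Γ p U V)

/-- The metric `g` on the group `M` is invariant under the tangent maps of right translations. -/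
def IsRightInvariant [Group M] (τ : M → E → M) (g : M → E → E → ℝ) : Prop :=
  ∀ p q : M, ∃ L : E →L[ℝ] E, HasTangentMapAt τ τ (fun r => r * q) p L ∧
    ∀ U V : E, g (p * q) (L U) (L V) = g p U V

end Manifold

/-! ## Smooth functions on the circle `S¹ = ℝ/ℤ` -/

/-- The algebra of smooth real functions on `ℝ/ℤ`. -/
def smoothSubalgebra : Subalgebra ℝ C(UnitAddCircle, ℝ) where
  carrier := {f | ContDiff ℝ ∞ (fun x : ℝ => f (x : UnitAddCircle))}
  mul_mem' {f g} hf hg := by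
    have hf : ContDiff ℝ ∞ (fun x : ℝ => f (x : UnitAddCircle)) := hf
    have hg : ContDiff ℝ ∞ (fun x : ℝ => g (x : UnitAddCircle)) := hg
    exact hf.mul hg
  add_mem' {f g} hf hg := by
    have hf : ContDiff ℝ ∞ (fun x : ℝ => f (x : UnitAddCircle)) := hf
    have hg : ContDiff ℝ ∞ (fun x : ℝ => g (x : UnitAddCircle)) := hg
    exact hf.add hg
  algebraMap_mem' r := (contDiff_const : ContDiff ℝ ∞ (fun _ : ℝ => r))

/-- `C^∞(S¹)`. Vector fields `u ∂ₓ` on `S¹` are identified with their coefficients `u`. -/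
def SmoothFn : Type := smoothSubalgebra

noncomputable instance : CommRing SmoothFn := inferInstanceAs (CommRing smoothSubalgebra)

noncomputable instance : Algebra ℝ SmoothFn := inferInstanceAs (Algebra ℝ smoothSubalgebra)

instance : CoeFun SmoothFn (fun _ => UnitAddCircle → ℝ) := ⟨fun f => f.1⟩

theorem SmoothFn.contDiff (f : SmoothFn) : ContDiff ℝ ∞ (fun x : ℝ => f (x : UnitAddCircle)) := f.2

theorem SmoothFn.periodic (f : SmoothFn) :
    Function.Periodic (fun x : ℝ => f (x : UnitAddCircle)) 1 := fun x => by
  simp only [AddCircle.coe_add_period]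

/-- The smooth function on `ℝ/ℤ` defined by a smooth `1`-periodic function on `ℝ`. -/
def SmoothFn.ofPeriodic (h : ℝ → ℝ) (hs : ContDiff ℝ ∞ h) (hp : Function.Periodic h 1) :
    SmoothFn :=
  ⟨⟨hp.lift, hs.continuous.quotient_liftOn' _⟩, hs⟩

theorem periodic_deriv {h : ℝ → ℝ} {c : ℝ} (hp : ∀ x, h (x + 1) = h x + c) :
    Function.Periodic (deriv h) 1 := fun x => by
  have h1 : (fun y => h (y + 1)) = fun y => h y + c := funext hp
  rw [← deriv_comp_add_const, h1, deriv_add_const]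

/-- The derivative `f ↦ f_x` on `C^∞(S¹)`. -/
noncomputable def SmoothFn.D (f : SmoothFn) : SmoothFn :=
  SmoothFn.ofPeriodic (deriv fun x : ℝ => f (x : UnitAddCircle))
    (contDiff_infty_iff_deriv.1 f.contDiff).2
    (periodic_deriv (c := 0) fun x => (f.periodic x).trans (add_zero _).symm)

/-- The `C^∞` topology: uniform convergence of all derivatives. -/
noncomputable instance : TopologicalSpace SmoothFn :=
  TopologicalSpace.induced
    (fun f (k : ℕ) => ((SmoothFn.D^[k] f).1 : C(UnitAddCircle, ℝ))) inferInstance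

/-- The integral `∫_{S¹} f dx` over the circle of length one. -/
noncomputable def integralS1 (f : SmoothFn) : ℝ := ∫ x in (0 : ℝ)..1, f (x : UnitAddCircle)

/-! ## The group of orientation preserving diffeomorphisms of the circle -/

/-- `σ : S¹ → S¹` lifts to a smooth map `h : ℝ → ℝ` with `h' > 0` and `h (x + 1) = h x + 1`. -/
def HasPositiveLift (σ : UnitAddCircle → UnitAddCircle) : Prop :=
  ∃ h : ℝ → ℝ, ContDiff ℝ ∞ h ∧ (∀ x, 0 < deriv h x) ∧ (∀ x, h (x + 1) = h x + 1) ∧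
    ∀ x : ℝ, σ (x : UnitAddCircle) = (h x : UnitAddCircle)

theorem HasPositiveLift.comp {σ ρ : UnitAddCircle → UnitAddCircle} (hσ : HasPositiveLift σ)
    (hρ : HasPositiveLift ρ) : HasPositiveLift (σ ∘ ρ) := by
  obtain ⟨h, h1, h2, h3, h4⟩ := hσ
  obtain ⟨k, k1, k2, k3, k4⟩ := hρ
  refine ⟨h ∘ k, h1.comp k1, fun x => ?_, fun x => by simp [k3, h3], fun x => by simp [k4, h4]⟩
  rw [deriv_comp x (h1.differentiable (by simp) _) (k1.differentiable (by simp) _)]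
  exact mul_pos (h2 _) (k2 _)

/-- The group of bijections `η` of `S¹` such that `η` and `η⁻¹` are smooth and orientation
preserving; the product is the composition. -/
def diffSubgroup : Subgroup (Equiv.Perm UnitAddCircle) where
  carrier := {σ | HasPositiveLift σ ∧ HasPositiveLift (σ⁻¹ : Equiv.Perm UnitAddCircle)}
  mul_mem' hσ hρ := ⟨hσ.1.comp hρ.1, by rw [mul_inv_rev]; exact hρ.2.comp hσ.2⟩
  one_mem' := by
    have h : HasPositiveLift (fun x => x) := ⟨fun x => x, contDiff_id, by simp, by simp, by simp⟩
    exact ⟨h, by rw [inv_one]; exact h⟩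
  inv_mem' hσ := ⟨hσ.2, by rw [inv_inv]; exact hσ.1⟩

/-- `Diff(S¹)`. -/
def DiffS1 : Type := diffSubgroup

instance : Group DiffS1 := inferInstanceAs (Group diffSubgroup)

instance : CoeFun DiffS1 (fun _ => UnitAddCircle → UnitAddCircle) := ⟨fun η => η.1⟩

namespace DiffS1

theorem mul_apply (η ξ : DiffS1) (x : UnitAddCircle) : (η * ξ) x = η (ξ x) := rfl

theorem continuous (η : DiffS1) : Continuous η := by
  obtain ⟨h, h1, -, -, h4⟩ := η.2.1
  have h5 : Continuous fun x : ℝ => η (x : UnitAddCircle) := by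
    rw [show (fun x : ℝ => η (x : UnitAddCircle)) = fun x : ℝ => (h x : UnitAddCircle) from
      funext h4]
    exact (AddCircle.continuous_mk' 1).comp h1.continuous
  exact continuous_coinduced_dom.2 h5

/-- A lift `h : ℝ → ℝ` of `η`; it is unique up to an integer constant. -/
noncomputable def lift (η : DiffS1) : ℝ → ℝ := η.2.1.choose

theorem lift_contDiff (η : DiffS1) : ContDiff ℝ ∞ η.lift := η.2.1.choose_spec.1

theorem lift_deriv_pos (η : DiffS1) (x : ℝ) : 0 < deriv η.lift x := η.2.1.choose_spec.2.1 x

theorem lift_add_one (η : DiffS1) (x : ℝ) : η.lift (x + 1) = η.lift x + 1 :=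
  η.2.1.choose_spec.2.2.1 x

theorem coe_lift (η : DiffS1) (x : ℝ) : η (x : UnitAddCircle) = (η.lift x : UnitAddCircle) :=
  η.2.1.choose_spec.2.2.2 x

/-- The derivative `η_x`, a positive smooth function on `S¹`. -/
noncomputable def D (η : DiffS1) : SmoothFn :=
  SmoothFn.ofPeriodic (deriv η.lift) (contDiff_infty_iff_deriv.1 η.lift_contDiff).2
    (periodic_deriv η.lift_add_one)

/-- `η_x` can be computed with any differentiable lift of `η`. -/
theorem D_eq_deriv (η : DiffS1) {h : ℝ → ℝ} (hd : Differentiable ℝ h)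
    (hl : ∀ x : ℝ, η (x : UnitAddCircle) = (h x : UnitAddCircle)) (x : ℝ) :
    η.D (x : UnitAddCircle) = deriv h x := by
  change deriv η.lift x = deriv h x
  have hint : ∀ y, ∃ m : ℤ, η.lift y - h y = m := fun y => by
    have h1 : ((η.lift y : ℝ) : UnitAddCircle) = (h y : UnitAddCircle) := by
      rw [← η.coe_lift, hl]
    rw [← sub_eq_zero, ← AddCircle.coe_sub, AddCircle.coe_eq_zero_iff] at h1
    obtain ⟨m, hm⟩ := h1
    exact ⟨m, by simpa using hm.symm⟩
  have hc : Continuous fun y => η.lift y - h y := η.lift_contDiff.continuous.sub hd.continuous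
  have hnear : ∀ᶠ y in 𝓝 x, dist (η.lift y - h y) (η.lift x - h x) < 1 :=
    hc.continuousAt.eventually (Metric.ball_mem_nhds _ one_pos)
  have heq : η.lift =ᶠ[𝓝 x] fun y => h y + (η.lift x - h x) := by
    filter_upwards [hnear] with y hy
    obtain ⟨m, hm⟩ := hint y
    obtain ⟨n, hn⟩ := hint x
    rw [hm, hn, Int.dist_cast_real, ← Int.dist_cast_real, Real.dist_eq] at hy
    have hmn : |m - n| < 1 := by exact_mod_cast hy
    have : m = n := by rw [Int.abs_lt_one_iff] at hmn; omega
    rw [hn, ← this, ← hm]; ring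
  rw [heq.deriv_eq, deriv_add_const]

/-- The `C^∞` topology: uniform convergence of `η` and of all its derivatives. -/
noncomputable instance : TopologicalSpace DiffS1 :=
  TopologicalSpace.induced
    (fun η => ((⟨η, η.continuous⟩ : C(UnitAddCircle, UnitAddCircle)), η.D)) inferInstance

/-- The function `ln η_x` on `S¹`. -/
noncomputable def logD (η : DiffS1) : SmoothFn :=
  SmoothFn.ofPeriodic (fun x => Real.log (deriv η.lift x))
    (ContDiff.log (contDiff_infty_iff_deriv.1 η.lift_contDiff).2
      fun x => (η.lift_deriv_pos x).ne')
    (fun x => by simp only [periodic_deriv η.lift_add_one x])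

theorem logD_apply (η : DiffS1) (x : UnitAddCircle) : η.logD x = Real.log (η.D x) := by
  induction x using QuotientAddGroup.induction_on
  rfl

open Classical in
/-- The local parametrization `φ ↦ η + φ` of `Diff(S¹)` around `η`, that is the diffeomorphism
`x ↦ η x + φ x` mod `1`. The value is irrelevant if this map is not in `Diff(S¹)`, which does not
happen if `η_x + φ_x > 0`. -/
noncomputable def translate (η : DiffS1) (φ : SmoothFn) : DiffS1 :=
  if h : ∃ σ : DiffS1, ∀ x : UnitAddCircle, σ x = η x + ((φ x : ℝ) : UnitAddCircle) then h.choose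
  else η

end DiffS1

/-- The composition `f ∘ η`. -/
noncomputable def SmoothFn.comp (f : SmoothFn) (η : DiffS1) : SmoothFn :=
  ⟨f.1.comp ⟨η, η.continuous⟩, by
    have : (fun x : ℝ => f (η (x : UnitAddCircle))) =
        (fun x : ℝ => f (x : UnitAddCircle)) ∘ η.lift := funext fun x => by simp [η.coe_lift]
    change ContDiff ℝ ∞ (fun x : ℝ => f (η (x : UnitAddCircle)))
    exact this ▸ f.contDiff.comp η.lift_contDiff⟩

theorem SmoothFn.comp_apply (f : SmoothFn) (η : DiffS1) (x : UnitAddCircle) :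
    f.comp η x = f (η x) := rfl

theorem SmoothFn.ext {f g : SmoothFn} (h : ∀ x, f x = g x) : f = g :=
  Subtype.ext (ContinuousMap.ext h)

/-! ## The semidirect product `Diff(S¹) ⋉ C^∞(S¹)` -/

/-- The set `Diff(S¹) × C^∞(S¹)` underlying the semidirect product. -/
@[ext]
structure SemiDiff : Type where
  /-- the component in `Diff(S¹)` -/
  diffeo : DiffS1
  /-- the component in `C^∞(S¹)` -/
  func : SmoothFn

namespace SemiDiff

noncomputable instance : Mul SemiDiff :=
  ⟨fun p q => ⟨p.diffeo * q.diffeo, p.func.comp q.diffeo + q.func⟩⟩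

noncomputable instance : One SemiDiff := ⟨⟨1, 0⟩⟩

noncomputable instance : Inv SemiDiff := ⟨fun p => ⟨p.diffeo⁻¹, -(p.func.comp p.diffeo⁻¹)⟩⟩

theorem mul_def (p q : SemiDiff) :
    p * q = ⟨p.diffeo * q.diffeo, p.func.comp q.diffeo + q.func⟩ := rfl

theorem one_def : (1 : SemiDiff) = ⟨1, 0⟩ := rfl

theorem inv_def (p : SemiDiff) : p⁻¹ = ⟨p.diffeo⁻¹, -(p.func.comp p.diffeo⁻¹)⟩ := rfl

/-- The group structure `(η, F) (ξ, G) = (η ∘ ξ, F ∘ ξ + G)`. -/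
noncomputable instance : Group SemiDiff :=
  Group.ofLeftAxioms
    (fun p q r => by
      simp only [mul_def]
      exact SemiDiff.ext (mul_assoc p.diffeo q.diffeo r.diffeo)
        (SmoothFn.ext fun x => add_assoc (p.func _) (q.func _) (r.func x)))
    (fun p => by
      simp only [mul_def, one_def, one_mul]
      exact SemiDiff.ext rfl (SmoothFn.ext fun x => zero_add _))
    (fun p => by
      simp only [mul_def, one_def, inv_def, inv_mul_cancel]
      refine SemiDiff.ext rfl (SmoothFn.ext fun x => ?_)
      change -(p.func (p.diffeo.1.symm (p.diffeo.1 x))) + p.func x = 0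
      simp)

/-- The product topology. -/
noncomputable instance : TopologicalSpace SemiDiff :=
  TopologicalSpace.induced (fun p => (p.diffeo, p.func)) inferInstance

/-- The local parametrization `(φ, K) ↦ (η + φ, F + K)` around `(η, F)`. -/
noncomputable def translate (p : SemiDiff) (X : SmoothFn × SmoothFn) : SemiDiff :=
  ⟨p.diffeo.translate X.1, p.func + X.2⟩

end SemiDiff

/-- The map `Υ(η) = (η, ln η_x)`. -/
noncomputable def Upsilon (η : DiffS1) : SemiDiff := ⟨η, η.logD⟩

/-! ## The right-invariant metrics

Right translation by `ξ` on `Diff(S¹)` is `η ↦ η ∘ ξ`, and its tangent maps are `U ↦ U ∘ ξ`; those of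
the right translation by `(ξ, G)` on the semidirect product are `(U, K) ↦ (U ∘ ξ, K ∘ ξ)`. -/

/-- The inner product `∫ (a u v + b u_x v_x) dx`. -/
noncomputable def innerH1 (a b : ℝ) (u v : SmoothFn) : ℝ :=
  integralS1 (a • (u * v) + b • (u.D * v.D))

/-- The inner product `∫ (a u v + b f g) dx` of `(u, f)` and `(v, g)`. -/
noncomputable def innerL2 (a b : ℝ) (X Y : SmoothFn × SmoothFn) : ℝ :=
  integralS1 (a • (X.1 * Y.1) + b • (X.2 * Y.2))

/-- The `a`-`b` metric: the right-invariant metric on `Diff(S¹)` that is `innerH1` at the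
identity, `⟨u ∘ η, v ∘ η⟩_η = ∫ (a u v + b u_x v_x) dx`. -/
noncomputable def abMetric (a b : ℝ) (η : DiffS1) (U V : SmoothFn) : ℝ :=
  innerH1 a b (U.comp η⁻¹) (V.comp η⁻¹)

/-- The right-invariant metric on the semidirect product that is `innerL2` at the identity. -/
noncomputable def semiMetric (a b : ℝ) (p : SemiDiff) (X Y : SmoothFn × SmoothFn) : ℝ :=
  innerL2 a b (X.1.comp p.diffeo⁻¹, X.2.comp p.diffeo⁻¹) (Y.1.comp p.diffeo⁻¹, Y.2.comp p.diffeo⁻¹)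

/-- The operator `A = a - b ∂ₓ²` on `C^∞(S¹)`. -/
noncomputable def opA (a b : ℝ) (f : SmoothFn) : SmoothFn := a • f - b • f.D.D

/-- The inverse of `A` (which is bijective for `a, b > 0`). -/
noncomputable def opAinv (a b : ℝ) : SmoothFn → SmoothFn := Function.invFun (opA a b)

/-- `Q(u, v) = -∂ₓ² A⁻¹ (a u v + (b/2) u_x v_x)`. -/
noncomputable def opQ (a b : ℝ) (u v : SmoothFn) : SmoothFn :=
  -(opAinv a b (a • (u * v) + (b / 2) • (u.D * v.D))).D.D

end CircleGeometry

open CircleGeometry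

/-! In the translation charts a tangent vector at `η` is `U = u ∘ η`, and conjugating `∂ₓ` by `η`
gives the derivation `∂ f = f_x / η_x` (`partialD`). After the substitution `x = η y` both metrics
are integrals against `η_x dx` of polynomials in the vectors and their `∂`-derivatives. No inverse
diffeomorphism remains, and `η` enters only through `η_x`. Along `η + t U` one has `(∂ f)˙ = -∂U ∂f`
and `(η_x)˙ = ∂U η_x`, so all the geometry reduces to identities modulo exact terms `∂ h`
(`integral_eq_of_sub_eq`).

On `Diff(S¹)` write `A = a - b ∂²` and `B(U, V) = a U V + (b/2) ∂U ∂V`. Then `Γ(U, V) = A⁻¹ ∂ B(U,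
V)`, and on `G` the Christoffel map is an explicit first order expression. For both metrics the
sectional expression is `⟨Γ(U,V), Γ(U,V)⟩ - ⟨Γ(U,U), Γ(V,V)⟩` (`abMetric_curvature`,
`semiMetric_curvature`).

The ambient derivative of `DΥ V` in the direction `DΥ U` is `((1/a) ∂B(U,V), 0) = ((1/a) A g, 0)`
with `g = Γ(U, V)`. Subtracting the tangential vector `(g, ∂g)` leaves `-((b/a) ∂² g, ∂g)`, which is
normal; this is `Π`, and `Q = -∂g` at the identity. Pythagoras for this splitting
(`integral_opA_mul_opA`) turns the difference of the two curvatures into the Gauss–Codazzi formula.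

The analytic point is that `A⁻¹` exists and can be differentiated in `η`. With `b c² = a`, `A = -b
(∂ - c)(∂ + c)`. Each factor is inverted by an integrating factor, and the maximum principle bounds
its inverse in the sup norm independently of `η` (`norm_le_of_D_eq`). The equation itself then
controls the higher derivatives (`tendsto_zero_of_opA`), which allows implicit differentiation of
`A⁻¹` (`hasVelocity_opAInv`). -/

namespace CircleGeometry

namespace SmoothFn

/-! ## Pointwise operations and the derivative on `C^∞(S¹)` -/

theorem add_apply (f g : SmoothFn) (x : UnitAddCircle) : (f + g) x = f x + g x := rfl
theorem sub_apply (f g : SmoothFn) (x : UnitAddCircle) : (f - g) x = f x - g x := rfl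
theorem neg_apply (f : SmoothFn) (x : UnitAddCircle) : (-f) x = -f x := rfl
theorem mul_apply (f g : SmoothFn) (x : UnitAddCircle) : (f * g) x = f x * g x := rfl
theorem smul_apply (c : ℝ) (f : SmoothFn) (x : UnitAddCircle) : (c • f) x = c * f x := rfl
theorem pow_apply (f : SmoothFn) (n : ℕ) (x : UnitAddCircle) : (f ^ n) x = f x ^ n := rfl
theorem zero_apply (x : UnitAddCircle) : (0 : SmoothFn) x = 0 := rfl
theorem one_apply (x : UnitAddCircle) : (1 : SmoothFn) x = 1 := rfl

/-- The inclusion of `C^∞(S¹)` into the Banach algebra of continuous functions. -/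
def toContinuousMap : SmoothFn →ₐ[ℝ] C(UnitAddCircle, ℝ) := smoothSubalgebra.val

theorem toContinuousMap_apply (f : SmoothFn) : toContinuousMap f = f.1 := rfl

theorem hasDerivAt (f : SmoothFn) (x : ℝ) :
    HasDerivAt (fun y : ℝ => f (y : UnitAddCircle)) (f.D x) x :=
  (f.contDiff.differentiable (by simp) x).hasDerivAt

theorem D_eq_of_hasDerivAt {f g : SmoothFn}
    (h : ∀ x : ℝ, HasDerivAt (fun y : ℝ => f (y : UnitAddCircle)) (g x) x) : f.D = g := by
  refine SmoothFn.ext fun x => ?_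
  induction x using QuotientAddGroup.induction_on with
  | H x => exact (h x).deriv

theorem D_add (f g : SmoothFn) : (f + g).D = f.D + g.D :=
  D_eq_of_hasDerivAt fun x => (f.hasDerivAt x).add (g.hasDerivAt x)

theorem D_smul (c : ℝ) (f : SmoothFn) : (c • f).D = c • f.D :=
  D_eq_of_hasDerivAt fun x => (f.hasDerivAt x).const_mul c

theorem D_mul (f g : SmoothFn) : (f * g).D = f.D * g + f * g.D :=
  D_eq_of_hasDerivAt fun x => (f.hasDerivAt x).mul (g.hasDerivAt x)

/-- The derivative as a linear map. -/
noncomputable def DLinear : SmoothFn →ₗ[ℝ] SmoothFn where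
  toFun := D
  map_add' := D_add
  map_smul' := D_smul

theorem D_sub (f g : SmoothFn) : (f - g).D = f.D - g.D := map_sub DLinear f g
theorem D_zero : (0 : SmoothFn).D = 0 := map_zero DLinear

theorem iterate_D_apply (k : ℕ) (f : SmoothFn) : D^[k] f = (DLinear ^ k) f := by
  rw [Module.End.pow_apply]; rfl

/-! ## The `C^∞` topology -/

/-- All derivatives at once, as a linear map into a product of Banach spaces. -/
noncomputable def jets : SmoothFn →ₗ[ℝ] ℕ → C(UnitAddCircle, ℝ) :=
  LinearMap.pi fun k => toContinuousMap.toLinearMap ∘ₗ DLinear ^ k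

theorem isInducing_jets : IsInducing jets := ⟨by
  have : (jets : SmoothFn → ℕ → C(UnitAddCircle, ℝ)) =
      fun f (k : ℕ) => ((D^[k] f).1 : C(UnitAddCircle, ℝ)) := by
    funext f k
    rw [iterate_D_apply]; rfl
  rw [this]; rfl⟩

instance : IsTopologicalAddGroup SmoothFn := isInducing_jets.topologicalAddGroup jets

instance : ContinuousSMul ℝ SmoothFn :=
  isInducing_jets.continuousSMul continuous_id (map_smul jets _ _)

/-- Convergence in `C^k`. -/
def TendstoCk {ι : Type*} (k : ℕ) (F : ι → SmoothFn) (l : Filter ι) (g : SmoothFn) : Prop :=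
  ∀ j ≤ k, Tendsto (fun t => (D^[j] (F t)).1) l (𝓝 (D^[j] g).1)

section

variable {ι : Type*} {l : Filter ι} {F G : ι → SmoothFn} {f g : SmoothFn} {k : ℕ}

theorem tendsto_iff_iterate_D :
    Tendsto F l (𝓝 g) ↔ ∀ k, Tendsto (fun t => (D^[k] (F t)).1) l (𝓝 (D^[k] g).1) := by
  rw [isInducing_jets.tendsto_nhds_iff, tendsto_pi_nhds]
  simp only [iterate_D_apply]
  rfl

theorem tendsto_iff_tendstoCk : Tendsto F l (𝓝 g) ↔ ∀ k, TendstoCk k F l g := by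
  rw [tendsto_iff_iterate_D]
  exact ⟨fun h k j _ => h j, fun h k => h k k le_rfl⟩

theorem tendstoCk_zero : TendstoCk 0 F l g ↔ Tendsto (fun t => (F t).1) l (𝓝 g.1) := by
  simp [TendstoCk]

theorem tendstoCk_succ :
    TendstoCk (k + 1) F l g ↔ TendstoCk 0 F l g ∧ TendstoCk k (fun t => (F t).D) l g.D := by
  constructor
  · intro h
    exact ⟨fun j hj => h j (by omega), fun j hj => by
      simpa only [Function.iterate_succ_apply] using h (j + 1) (by omega)⟩
  · rintro ⟨h0, h1⟩ j hj
    cases j with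
    | zero => exact h0 0 le_rfl
    | succ j => simpa only [Function.iterate_succ_apply] using h1 j (by omega)

theorem TendstoCk.mono (h : TendstoCk k F l g) {j : ℕ} (hj : j ≤ k) : TendstoCk j F l g :=
  fun i hi => h i (hi.trans hj)

theorem TendstoCk.add (hF : TendstoCk k F l f) (hG : TendstoCk k G l g) :
    TendstoCk k (fun t => F t + G t) l (f + g) := fun j hj => by
  have := (hF j hj).add (hG j hj)
  simp only [iterate_D_apply, map_add] at this ⊢
  exact this

/-- The Leibniz rule writes the derivative of a product through products one order lower, so the
induction has to run on finite orders `C^k` and not on the `C^∞` topology. -/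
theorem TendstoCk.mul (hF : TendstoCk k F l f) (hG : TendstoCk k G l g) :
    TendstoCk k (fun t => F t * G t) l (f * g) := by
  induction k generalizing F G f g with
  | zero =>
    rw [tendstoCk_zero] at *
    exact hF.mul hG
  | succ k ih =>
    have h0 : TendstoCk 0 (fun t => F t * G t) l (f * g) :=
      tendstoCk_zero.2 ((tendstoCk_zero.1 (hF.mono (Nat.zero_le _))).mul
        (tendstoCk_zero.1 (hG.mono (Nat.zero_le _))))
    refine tendstoCk_succ.2 ⟨h0, ?_⟩
    simp only [D_mul]
    exact (ih (tendstoCk_succ.1 hF).2 (hG.mono k.le_succ)).add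
      (ih (hF.mono k.le_succ) (tendstoCk_succ.1 hG).2)

end

instance : ContinuousMul SmoothFn := ⟨by
  rw [continuous_iff_continuousAt]
  rintro ⟨f, g⟩
  refine tendsto_iff_tendstoCk.2 fun k => ?_
  exact (tendsto_iff_tendstoCk.1 (continuous_fst.tendsto (f, g)) k).mul
    (tendsto_iff_tendstoCk.1 (continuous_snd.tendsto (f, g)) k)⟩

theorem continuous_toContinuousMap : Continuous toContinuousMap :=
  continuous_iff_continuousAt.2 fun f =>
    tendsto_iff_iterate_D.1 (tendsto_id (x := 𝓝 f)) 0

theorem continuous_D : Continuous D :=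
  continuous_iff_continuousAt.2 fun f => tendsto_iff_iterate_D.2 fun k => by
    simpa only [Function.iterate_succ_apply, id_eq] using
      tendsto_iff_iterate_D.1 (tendsto_id (x := 𝓝 f)) (k + 1)

theorem continuous_eval (x : UnitAddCircle) : Continuous fun f : SmoothFn => f x :=
  (continuous_eval_const x).comp continuous_toContinuousMap

/-- The derivative as a continuous linear map. -/
noncomputable def DCLM : SmoothFn →L[ℝ] SmoothFn := ⟨DLinear, continuous_D⟩

theorem DCLM_apply (f : SmoothFn) : DCLM f = f.D := rfl

instance : T2Space SmoothFn :=
  T2Space.of_injective_continuous (f := toContinuousMap) Subtype.val_injective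
    continuous_toContinuousMap

theorem abs_apply_le_norm (f : SmoothFn) (x : UnitAddCircle) : |f x| ≤ ‖f.1‖ :=
  f.1.norm_coe_le_norm x

/-- Mean value inequality along the arc from `0` to the representative of `x` in `[0, 1)`, whose
length is less than one. -/
theorem norm_sub_apply_zero_le (f : SmoothFn) (x : UnitAddCircle) : |f x - f 0| ≤ ‖f.D.1‖ := by
  obtain ⟨y, hy, rfl⟩ : ∃ y ∈ Ico (0 : ℝ) 1, (y : UnitAddCircle) = x := by
    have := AddCircle.coe_image_Ico_eq (1 : ℝ) 0
    have h := this ▸ mem_univ x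
    simpa using h
  have h := norm_image_sub_le_of_norm_deriv_le_segment_01'
    (f := fun t : ℝ => f ((t * y : ℝ) : UnitAddCircle)) (f' := fun t => f.D ((t * y : ℝ)) * y)
    (C := ‖f.D.1‖) (fun t _ => ?_) fun t _ => ?_
  · simpa using h
  · have h1 : HasDerivAt (fun t : ℝ => t * y) (1 * y) t := (hasDerivAt_id t).mul_const y
    have := (f.hasDerivAt (t * y)).comp t h1
    rw [one_mul] at this
    exact this.hasDerivWithinAt
  · rw [norm_mul, Real.norm_eq_abs, Real.norm_eq_abs, abs_of_nonneg hy.1]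
    exact (mul_le_of_le_one_right (abs_nonneg _) hy.2.le).trans (f.D.abs_apply_le_norm _)

/-- Convergence in `C^∞(S¹)` follows from that of the derivatives and of the values at a point. -/
theorem tendsto_of_D {ι : Type*} {l : Filter ι} {F : ι → SmoothFn} {g : SmoothFn}
    (hD : Tendsto (fun t => (F t).D) l (𝓝 g.D)) (h0 : Tendsto (fun t => F t 0) l (𝓝 (g 0))) :
    Tendsto F l (𝓝 g) := by
  refine tendsto_iff_iterate_D.2 fun k => ?_
  cases k with
  | succ k => exact tendsto_iff_iterate_D.1 hD k
  | zero =>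
    have hD0 := tendsto_iff_iterate_D.1 hD 0
    simp only [Function.iterate_zero, id_eq] at hD0 ⊢
    rw [tendsto_iff_norm_sub_tendsto_zero] at hD0 h0 ⊢
    have hsum := hD0.add h0
    rw [add_zero] at hsum
    refine squeeze_zero (fun _ => norm_nonneg _) (fun t => ?_) hsum
    refine (ContinuousMap.norm_le _ (by positivity)).2 fun x => ?_
    have h1 := (F t - g).norm_sub_apply_zero_le x
    rw [D_sub] at h1
    have h2 : ((F t).1 - g.1) x = ((F t - g) x - (F t - g) 0) + (F t 0 - g 0) := by
      simp only [sub_apply, ContinuousMap.sub_apply]; ring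
    rw [h2]
    exact (norm_add_le _ _).trans (add_le_add h1 le_rfl)

/-! ## Inverse and logarithm of positive functions -/

open Classical in
/-- The inverse `1 / f` of a positive function (`0` if `f` is not positive). -/
noncomputable def inv (f : SmoothFn) : SmoothFn :=
  if h : ∀ x, 0 < f x then
    ofPeriodic (fun x : ℝ => (f (x : UnitAddCircle))⁻¹) (f.contDiff.inv fun x => (h x).ne')
      fun x => congrArg Inv.inv (f.periodic x)
  else 0

open Classical in
/-- The logarithm of a positive function (`0` if `f` is not positive). -/
noncomputable def log (f : SmoothFn) : SmoothFn :=
  if h : ∀ x, 0 < f x then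
    ofPeriodic (fun x : ℝ => Real.log (f (x : UnitAddCircle))) (f.contDiff.log fun x => (h x).ne')
      fun x => congrArg Real.log (f.periodic x)
  else 0

/-- The positive functions. -/
def positive : Set SmoothFn := {f | ∀ x, 0 < f x}

variable {f : SmoothFn}

theorem inv_apply (h : f ∈ positive) (x : UnitAddCircle) : f.inv x = (f x)⁻¹ := by
  rw [inv, dif_pos (show ∀ x, 0 < f x from h)]
  induction x using QuotientAddGroup.induction_on with
  | H x => rfl

theorem log_apply (h : f ∈ positive) (x : UnitAddCircle) : f.log x = Real.log (f x) := by
  rw [log, dif_pos (show ∀ x, 0 < f x from h)]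
  induction x using QuotientAddGroup.induction_on with
  | H x => rfl

theorem mul_inv (h : f ∈ positive) : f * f.inv = 1 :=
  SmoothFn.ext fun x => by
    rw [mul_apply, inv_apply h, one_apply, mul_inv_cancel₀ (h x).ne']

theorem D_inv (h : f ∈ positive) : f.inv.D = -(f.inv * f.inv * f.D) :=
  D_eq_of_hasDerivAt fun x => by
    have := (f.hasDerivAt x).inv (h x).ne'
    simp only [inv_apply h, neg_apply, mul_apply]
    refine this.congr_deriv ?_
    rw [div_eq_mul_inv, sq, _root_.mul_inv_rev]
    ring

theorem D_log (h : f ∈ positive) : f.log.D = f.inv * f.D :=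
  D_eq_of_hasDerivAt fun x => by
    have := (f.hasDerivAt x).log (h x).ne'
    simp only [log_apply h, inv_apply h, mul_apply]
    convert this using 1
    ring

theorem isOpen_positive : IsOpen positive := by
  have h := (ContinuousMap.isOpen_setOfPred_mapsTo (isCompact_univ (X := UnitAddCircle))
    (isOpen_Ioi (a := (0 : ℝ)))).preimage continuous_toContinuousMap
  convert h using 1
  ext f
  simp [positive, MapsTo, toContinuousMap_apply]

theorem exists_pos_forall_le (h : f ∈ positive) : ∃ δ > 0, ∀ x, δ ≤ f x := by
  obtain ⟨x, -, hx⟩ := isCompact_univ.exists_isMinOn univ_nonempty f.1.continuous.continuousOn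
  exact ⟨f x, h x, fun y => hx (mem_univ y)⟩

section

variable {ι : Type*} {l : Filter ι} {F : ι → SmoothFn}

/-- Sup norm convergence comes from composition with a continuous function; the identity `(1/f)' =
-(1/f)² f'` then raises the order one step at a time. -/
theorem tendsto_inv (h : f ∈ positive) (hF : Tendsto F l (𝓝 f)) :
    Tendsto (fun t => (F t).inv) l (𝓝 f.inv) := by
  have hpos : ∀ᶠ t in l, F t ∈ positive := hF (isOpen_positive.mem_nhds h)
  have h0 : TendstoCk 0 (fun t => (F t).inv) l f.inv := by
    obtain ⟨δ, hδ, hδf⟩ := exists_pos_forall_le h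
    -- Truncation at `δ / 2` makes the reciprocal continuous on all of `ℝ` without changing it on
    -- values of functions uniformly close to `f`.
    let g : C(ℝ, ℝ) := ⟨fun x => (max x (δ / 2))⁻¹,
      (continuous_id.max continuous_const).inv₀ fun x => (lt_max_of_lt_right (half_pos hδ)).ne'⟩
    have hg : ∀ f' : SmoothFn, (∀ x, δ / 2 ≤ f' x) → g.comp f'.1 = f'.inv.1 := fun f' hf' => by
      ext x
      rw [inv_apply fun x => (half_pos hδ).trans_le (hf' x)]
      exact congrArg Inv.inv (max_eq_left (hf' x))
    have hlim := tendsto_iff_iterate_D.1 hF 0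
    simp only [Function.iterate_zero, id_eq] at hlim
    have hcont := ((ContinuousMap.continuous_postcomp g).tendsto f.1).comp hlim
    rw [tendstoCk_zero, ← hg f fun x => (half_le_self hδ.le).trans (hδf x)]
    refine hcont.congr' ?_
    filter_upwards [hlim (Metric.ball_mem_nhds _ (half_pos hδ))] with t ht
    refine hg _ fun x => ?_
    have h1 := (ContinuousMap.dist_apply_le_dist (f := (F t).1) (g := f.1) x).trans_lt ht
    rw [Real.dist_eq, abs_lt] at h1
    linarith [hδf x, h1.1]
  refine tendsto_iff_tendstoCk.2 fun k => ?_
  induction k with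
  | zero => exact h0
  | succ k ih =>
    refine tendstoCk_succ.2 ⟨h0, ?_⟩
    have h1 := ((ih.mul ih).mul (tendsto_iff_tendstoCk.1 ((continuous_D.tendsto f).comp hF) k)).mul
      (G := fun _ => -1) (g := -1) fun j _ => tendsto_const_nhds
    rw [D_inv h]
    intro j hj
    have h2 := h1 j hj
    rw [mul_neg_one] at h2
    refine h2.congr' ?_
    filter_upwards [hpos] with t ht
    rw [D_inv ht, mul_neg_one]; rfl

/-- The derivative `f' / f` is controlled by `tendsto_inv`, and the value at one point fixes the
constant of integration. -/
theorem tendsto_log (h : f ∈ positive) (hF : Tendsto F l (𝓝 f)) :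
    Tendsto (fun t => (F t).log) l (𝓝 f.log) := by
  have hpos : ∀ᶠ t in l, F t ∈ positive := hF (isOpen_positive.mem_nhds h)
  refine tendsto_of_D ?_ ?_
  · rw [D_log h]
    refine ((tendsto_inv h hF).mul ((continuous_D.tendsto f).comp hF)).congr' ?_
    filter_upwards [hpos] with t ht
    rw [D_log ht]; rfl
  · rw [log_apply h]
    refine (((continuous_eval 0).tendsto f).comp hF).log (h 0).ne' |>.congr' ?_
    filter_upwards [hpos] with t ht
    rw [log_apply ht]; rfl

/-- The maximum principle for a first order periodic equation. -/
theorem norm_le_of_D_eq {E f h : SmoothFn} {c : ℝ} (hc : c ≠ 0) (hE : ∀ x, E x ≠ 0)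
    (heq : f.D = E * (h - c • f)) : ‖f.1‖ ≤ ‖h.1‖ / |c| := by
  -- At an extremum `f' = 0`, and `E ≠ 0` can be divided out. This is why the final bound does not
  -- involve `E`.
  have key : ∀ x, IsExtrOn f.1 univ x → c * f x = h x := fun x hx => by
    induction x using QuotientAddGroup.induction_on with
    | H y =>
      have h1 : IsLocalExtr (fun z : ℝ => f (z : UnitAddCircle)) y := by
        refine IsExtrFilter.filter_mono (l := ⊤) ?_ le_top
        rcases hx with hx | hx
        · exact Or.inl (eventually_top.2 fun z => hx (mem_univ _))
        · exact Or.inr (eventually_top.2 fun z => hx (mem_univ _))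
      have h2 : f.D (y : UnitAddCircle) = 0 := h1.hasDerivAt_eq_zero (f.hasDerivAt y)
      rw [heq, mul_apply, sub_apply, smul_apply] at h2
      have := (mul_eq_zero.1 h2).resolve_left (hE _)
      exact (sub_eq_zero.1 this).symm
  have hext : ∀ x, IsExtrOn f.1 univ x → |f x| ≤ ‖h.1‖ / |c| := fun x hx => by
    rw [le_div_iff₀' (abs_pos.2 hc), ← abs_mul, key x hx]
    exact h.abs_apply_le_norm x
  obtain ⟨x, -, hx⟩ := isCompact_univ.exists_isMinOn univ_nonempty f.1.continuous.continuousOn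
  obtain ⟨y, -, hy⟩ := isCompact_univ.exists_isMaxOn univ_nonempty f.1.continuous.continuousOn
  refine (ContinuousMap.norm_le _ (by positivity)).2 fun z => ?_
  exact (abs_le_max_abs_abs (hx (mem_univ z)) (hy (mem_univ z))).trans
    (max_le (hext x (Or.inl hx)) (hext y (Or.inr hy)))

/-- Solutions of first order periodic equations converge to `0` in `C^∞(S¹)` with the right-hand
side. -/
theorem tendsto_zero_of_D_eq {E H : ι → SmoothFn} {e : SmoothFn} {c : ℝ} (hc : c ≠ 0)
    (hE : Tendsto E l (𝓝 e)) (hE0 : ∀ t x, E t x ≠ 0) (hH : Tendsto H l (𝓝 0))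
    (heq : ∀ t, (F t).D = E t * (H t - c • F t)) : Tendsto F l (𝓝 0) := by
  have h0 : TendstoCk 0 F l 0 := by
    rw [tendstoCk_zero]
    have hlim := tendsto_iff_iterate_D.1 hH 0
    simp only [Function.iterate_zero, id_eq] at hlim
    refine squeeze_zero_norm (fun t => norm_le_of_D_eq hc (hE0 t) (heq t)) ?_
    simpa using (tendsto_zero_iff_norm_tendsto_zero.1 hlim).div_const |c|
  refine tendsto_iff_tendstoCk.2 fun k => ?_
  induction k with
  | zero => exact h0
  | succ k ih =>
    refine tendstoCk_succ.2 ⟨h0, ?_⟩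
    -- Bootstrap: the right-hand side of the equation contains no derivative of `F t`, so its `C^k`
    -- convergence gives that of `(F t).D`.
    have h1 := (tendsto_iff_tendstoCk.1 hE k).mul ((tendsto_iff_tendstoCk.1 hH k).add
      (ih.mul (G := fun _ => (-c) • 1) (g := (-c) • 1) fun j _ => tendsto_const_nhds))
    simp only [mul_smul_comm, mul_one, smul_zero, add_zero, mul_zero] at h1
    simp only [heq, D_zero, sub_eq_add_neg, ← neg_smul]
    exact h1

end

end SmoothFn

/-! ## Composition with diffeomorphisms -/

namespace SmoothFn

theorem add_comp (f g : SmoothFn) (η : DiffS1) : (f + g).comp η = f.comp η + g.comp η := rfl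
theorem sub_comp (f g : SmoothFn) (η : DiffS1) : (f - g).comp η = f.comp η - g.comp η := rfl
theorem neg_comp (f : SmoothFn) (η : DiffS1) : (-f).comp η = -f.comp η := rfl
theorem smul_comp (c : ℝ) (f : SmoothFn) (η : DiffS1) : (c • f).comp η = c • f.comp η := rfl
theorem comp_comp (f : SmoothFn) (η ξ : DiffS1) : (f.comp η).comp ξ = f.comp (η * ξ) := rfl
theorem comp_one (f : SmoothFn) : f.comp 1 = f := rfl

theorem comp_inv_comp (f : SmoothFn) (η : DiffS1) : (f.comp η⁻¹).comp η = f := by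
  rw [comp_comp, inv_mul_cancel, comp_one]

theorem comp_comp_inv (f : SmoothFn) (η : DiffS1) : (f.comp η).comp η⁻¹ = f := by
  rw [comp_comp, mul_inv_cancel, comp_one]

theorem D_comp (f : SmoothFn) (η : DiffS1) : (f.comp η).D = f.D.comp η * η.D :=
  D_eq_of_hasDerivAt fun x => by
    have h := (f.hasDerivAt (η.lift x)).comp x
      (η.lift_contDiff.differentiable (by simp) x).hasDerivAt
    have h1 : (fun y : ℝ => f.comp η (y : UnitAddCircle)) =
        (fun y : ℝ => f (y : UnitAddCircle)) ∘ η.lift :=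
      funext fun y => by simp [comp_apply, η.coe_lift]
    rw [h1, mul_apply, comp_apply, η.coe_lift]
    exact h

theorem TendstoCk.comp {ι : Type*} {l : Filter ι} {F : ι → SmoothFn} {f : SmoothFn} {k : ℕ}
    (h : TendstoCk k F l f) (η : DiffS1) : TendstoCk k (fun t => (F t).comp η) l (f.comp η) := by
  have h0 : ∀ {F : ι → SmoothFn} {f : SmoothFn}, TendstoCk 0 F l f →
      TendstoCk 0 (fun t => (F t).comp η) l (f.comp η) := fun h => by
    rw [tendstoCk_zero] at h ⊢
    exact ((ContinuousMap.continuous_precomp ⟨η, η.continuous⟩).tendsto _).comp h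
  induction k generalizing F f with
  | zero => exact h0 h
  | succ k ih =>
    rw [tendstoCk_succ] at h ⊢
    refine ⟨h0 h.1, ?_⟩
    simp only [D_comp]
    exact (ih h.2).mul fun j _ => tendsto_const_nhds

/-- Composition with a diffeomorphism as a continuous linear map. -/
noncomputable def compCLM (η : DiffS1) : SmoothFn →L[ℝ] SmoothFn where
  toFun f := f.comp η
  map_add' _ _ := rfl
  map_smul' _ _ := rfl
  cont := continuous_iff_continuousAt.2 fun f => tendsto_iff_tendstoCk.2 fun k =>
    (tendsto_iff_tendstoCk.1 (tendsto_id (x := 𝓝 f)) k).comp η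

theorem compCLM_apply (η : DiffS1) (f : SmoothFn) : compCLM η f = f.comp η := rfl

/-! ## Integration -/

theorem continuous_coe (f : SmoothFn) : Continuous fun x : ℝ => f (x : UnitAddCircle) :=
  f.contDiff.continuous

/-- The integral as a continuous linear functional. -/
noncomputable def integralCLM : SmoothFn →L[ℝ] ℝ where
  toFun := integralS1
  map_add' f g := intervalIntegral.integral_add (f.continuous_coe.intervalIntegrable _ _)
    (g.continuous_coe.intervalIntegrable _ _)
  map_smul' c f := intervalIntegral.integral_const_mul c _
  cont := by
    rw [continuous_iff_continuousAt]
    intro f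
    have hlim : Tendsto (fun g : SmoothFn => g.1) (𝓝 f) (𝓝 f.1) :=
      continuous_toContinuousMap.tendsto f
    rw [tendsto_iff_norm_sub_tendsto_zero] at hlim
    refine tendsto_iff_norm_sub_tendsto_zero.2
      (squeeze_zero (fun _ => norm_nonneg _) (fun g => ?_) hlim)
    have h1 : integralS1 g - integralS1 f =
        ∫ x in (0 : ℝ)..1, (g (x : UnitAddCircle) - f (x : UnitAddCircle)) :=
      (intervalIntegral.integral_sub (g.continuous_coe.intervalIntegrable _ _)
        (f.continuous_coe.intervalIntegrable _ _)).symm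
    change ‖integralS1 g - integralS1 f‖ ≤ _
    rw [h1]
    refine (intervalIntegral.norm_integral_le_of_norm_le_const (C := ‖g.1 - f.1‖)
      fun x _ => ?_).trans (by simp)
    exact (g - f).abs_apply_le_norm x

theorem integralCLM_apply (f : SmoothFn) : integralCLM f = integralS1 f := rfl

theorem integralS1_D (f : SmoothFn) : integralS1 f.D = 0 := by
  have h := intervalIntegral.integral_eq_sub_of_hasDerivAt (a := 0) (b := 1)
    (fun x _ => f.hasDerivAt x) (f.D.continuous_coe.intervalIntegrable _ _)
  have h1 := f.periodic 0
  rw [zero_add] at h1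
  exact h.trans (sub_eq_zero.2 h1)

theorem integralS1_comp_mul_D (f : SmoothFn) (η : DiffS1) :
    integralS1 (f.comp η * η.D) = integralS1 f := by
  have h1 : ∫ x in (0 : ℝ)..1, f (η.lift x : UnitAddCircle) * deriv η.lift x =
      ∫ x in η.lift 0..η.lift 1, f (x : UnitAddCircle) :=
    intervalIntegral.integral_comp_mul_deriv (f := η.lift)
      (g := fun x : ℝ => f (x : UnitAddCircle))
      (fun x _ => (η.lift_contDiff.differentiable (by simp) x).hasDerivAt)
      (contDiff_infty_iff_deriv.1 η.lift_contDiff).2.continuous.continuousOn f.continuous_coe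
  have h2 := η.lift_add_one 0
  rw [zero_add] at h2
  rw [h2, f.periodic.intervalIntegral_add_eq _ 0, zero_add] at h1
  refine Eq.trans (intervalIntegral.integral_congr fun x _ => ?_) h1
  change f (η x) * η.D x = f (η.lift x : UnitAddCircle) * deriv η.lift x
  rw [η.coe_lift]; rfl

theorem integralS1_comp_inv (f : SmoothFn) (η : DiffS1) :
    integralS1 (f.comp η⁻¹) = integralS1 (f * η.D) := by
  rw [← integralS1_comp_mul_D _ η, comp_inv_comp]

end SmoothFn

/-! ### Diffeomorphisms given by lifts, and the translation charts -/

namespace DiffS1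

open SmoothFn

theorem D_mem_positive (η : DiffS1) : η.D ∈ positive := fun x => by
  induction x using QuotientAddGroup.induction_on with
  | H x => exact η.lift_deriv_pos x

theorem logD_eq (η : DiffS1) : η.logD = η.D.log :=
  SmoothFn.ext fun x => by rw [logD_apply, log_apply η.D_mem_positive]

theorem ext {η ξ : DiffS1} (h : ∀ x, η x = ξ x) : η = ξ := Subtype.ext (Equiv.ext h)

theorem D_mul (η ξ : DiffS1) : (η * ξ).D = η.D.comp ξ * ξ.D :=
  SmoothFn.ext fun x => by
    induction x using QuotientAddGroup.induction_on with
    | H x =>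
      have hη := η.lift_contDiff.differentiable (by simp)
      have hξ := ξ.lift_contDiff.differentiable (by simp)
      have h1 := (η * ξ).D_eq_deriv (h := η.lift ∘ ξ.lift) (hη.comp hξ)
        (fun y => by rw [mul_apply, ξ.coe_lift, η.coe_lift]; rfl) x
      refine h1.trans ?_
      rw [deriv_comp x (hη _) (hξ _), SmoothFn.mul_apply, comp_apply, ξ.coe_lift]
      rfl

/-- A smooth increasing function `h` with `h (x + 1) = h x + 1` defines a diffeomorphism. -/
theorem exists_of_lift {h : ℝ → ℝ} (hs : ContDiff ℝ ∞ h) (hpos : ∀ x, 0 < deriv h x)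
    (h1 : ∀ x, h (x + 1) = h x + 1) : ∃ σ : DiffS1, ∀ x : ℝ, σ x = (h x : UnitAddCircle) := by
  have hmono : StrictMono h := strictMono_of_deriv_pos hpos
  have hnat : ∀ n : ℕ, ∀ x, h (x + n) = h x + n := fun n => by
    induction n with
    | zero => simp
    | succ n ih => intro x; push_cast; rw [← add_assoc, h1, ih, add_assoc]
  have hint : ∀ (n : ℤ) (x), h (x + n) = h x + n := fun n x => by
    rcases n.eq_nat_or_neg with ⟨m, rfl | rfl⟩
    · exact_mod_cast hnat m x
    · have := hnat m (x + ((-m : ℤ) : ℝ))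
      push_cast at this ⊢
      rw [neg_add_cancel_right] at this
      linarith
  -- Monotonicity and `h (x + n) = h x + n` force both infinite limits, hence surjectivity.
  have htop : Tendsto h atTop atTop := by
    refine tendsto_atTop.2 fun y => ?_
    obtain ⟨n, hn⟩ := exists_nat_ge (y - h 0)
    filter_upwards [eventually_ge_atTop (n : ℝ)] with x hx
    have := hmono.monotone hx
    have h2 := hnat n 0
    rw [zero_add] at h2
    linarith
  have hbot : Tendsto h atBot atBot := by
    refine tendsto_atBot.2 fun y => ?_
    obtain ⟨n, hn⟩ := exists_nat_ge (h 0 - y)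
    filter_upwards [eventually_le_atBot (-n : ℝ)] with x hx
    have := hmono.monotone hx
    have h2 := hint (-n) 0
    push_cast at h2
    rw [zero_add] at h2
    linarith
  let e : ℝ ≃o ℝ := hmono.orderIsoOfSurjective h (hs.continuous.surjective htop hbot)
  have he : ∀ x, e x = h x := fun x => rfl
  have hes : ContDiff ℝ ∞ e.toHomeomorph.symm :=
    e.toHomeomorph.contDiff_symm_deriv (fun x => (hpos x).ne')
      (fun x => (hs.differentiable (by simp) x).hasDerivAt) hs
  have hsymm : ∀ x, e.symm (x + 1) = e.symm x + 1 := fun x => by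
    rw [e.symm_apply_eq, he, h1, ← he, e.apply_symm_apply]
  have hsymmpos : ∀ x, 0 < deriv e.symm x := fun x => by
    have h2 := (hs.differentiable (by simp) (e.symm x)).hasDerivAt.of_local_left_inverse
      (hes.continuous.continuousAt (x := x)) (hpos _).ne'
      (Eventually.of_forall fun y => e.apply_symm_apply y)
    have h3 : deriv e.symm x = (deriv h (e.symm x))⁻¹ := h2.deriv
    rw [h3]
    exact inv_pos.2 (hpos _)
  have hF : Function.Periodic (fun x : ℝ => (h x : UnitAddCircle)) 1 := fun x => by
    simp only [h1, AddCircle.coe_add_period]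
  have hG : Function.Periodic (fun x : ℝ => (e.symm x : UnitAddCircle)) 1 := fun x => by
    simp only [hsymm, AddCircle.coe_add_period]
  let σ : Equiv.Perm UnitAddCircle :=
    { toFun := hF.lift
      invFun := hG.lift
      left_inv := fun x => by
        induction x using QuotientAddGroup.induction_on with
        | H x => exact congrArg _ (e.symm_apply_apply x)
      right_inv := fun x => by
        induction x using QuotientAddGroup.induction_on with
        | H x => exact congrArg _ (e.apply_symm_apply x) }
  exact ⟨⟨σ, ⟨h, hs, hpos, h1, fun x => rfl⟩, ⟨e.symm, hes, hsymmpos, hsymm, fun x => rfl⟩⟩,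
    fun x => rfl⟩

theorem translate_apply_of_exists {η : DiffS1} {φ : SmoothFn} {σ : DiffS1}
    (h : ∀ x, σ x = η x + ((φ x : ℝ) : UnitAddCircle)) : η.translate φ = σ := by
  have hex : ∃ σ : DiffS1, ∀ x : UnitAddCircle, σ x = η x + ((φ x : ℝ) : UnitAddCircle) := ⟨σ, h⟩
  rw [translate, dif_pos hex]
  exact ext fun x => (hex.choose_spec x).trans (h x).symm

theorem exists_translate {η : DiffS1} {φ : SmoothFn} (h : η.D + φ.D ∈ positive) :
    ∃ σ : DiffS1, (∀ x, σ x = η x + ((φ x : ℝ) : UnitAddCircle)) ∧ σ.D = η.D + φ.D := by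
  have hη := η.lift_contDiff.differentiable (by simp)
  have hderiv : ∀ x : ℝ, HasDerivAt (fun y : ℝ => η.lift y + φ (y : UnitAddCircle))
      ((η.D + φ.D) x) x := fun x => (hη x).hasDerivAt.add (φ.hasDerivAt x)
  obtain ⟨σ, hσ⟩ := exists_of_lift (h := fun x : ℝ => η.lift x + φ (x : UnitAddCircle))
    (η.lift_contDiff.add φ.contDiff) (fun x => by rw [(hderiv x).deriv]; exact h x)
    (fun x => by
      have := φ.periodic x
      simp only at this
      rw [η.lift_add_one, this]; ring)
  refine ⟨σ, fun x => ?_, SmoothFn.ext fun x => ?_⟩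
  · induction x using QuotientAddGroup.induction_on with
    | H x => exact (hσ x).trans (by rw [AddCircle.coe_add, ← η.coe_lift])
  · induction x using QuotientAddGroup.induction_on with
    | H x =>
      exact (σ.D_eq_deriv (fun x => (hderiv x).differentiableAt) hσ x).trans (hderiv x).deriv

theorem D_translate {η : DiffS1} {φ : SmoothFn} (h : η.D + φ.D ∈ positive) :
    (η.translate φ).D = η.D + φ.D := by
  obtain ⟨σ, hσ, hD⟩ := exists_translate h
  rw [translate_apply_of_exists hσ, hD]

theorem translate_zero (η : DiffS1) : η.translate 0 = η :=
  translate_apply_of_exists fun x => by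
    rw [SmoothFn.zero_apply]; exact (add_zero _).symm

/-- Right translation is linear in the charts, even outside their domain: `η + φ` is a
diffeomorphism exactly when `η ∘ ξ + φ ∘ ξ` is, and otherwise the default values `η` and `η * ξ`
also correspond. -/
theorem translate_mul (η ξ : DiffS1) (φ : SmoothFn) :
    η.translate φ * ξ = (η * ξ).translate (φ.comp ξ) := by
  by_cases h : ∃ σ : DiffS1, ∀ x : UnitAddCircle, σ x = η x + ((φ x : ℝ) : UnitAddCircle)
  · obtain ⟨σ, hσ⟩ := h
    rw [translate_apply_of_exists hσ]
    exact (translate_apply_of_exists fun x => hσ (ξ x)).symm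
  · have h' : ¬∃ σ : DiffS1, ∀ x : UnitAddCircle,
        σ x = (η * ξ) x + ((φ.comp ξ x : ℝ) : UnitAddCircle) := fun ⟨σ, hσ⟩ => by
      refine h ⟨σ * ξ⁻¹, fun x => ?_⟩
      have h1 : ξ (ξ⁻¹ x) = x := ξ.1.apply_symm_apply x
      have h2 := hσ (ξ⁻¹ x)
      rw [mul_apply, comp_apply, h1] at h2
      exact h2
    rw [translate, dif_neg h, translate, dif_neg h']

/-! ## Derivatives in the coordinate of a diffeomorphism -/

/-- The function `1 / η_x`. -/
noncomputable def invD (η : DiffS1) : SmoothFn := η.D.inv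

theorem D_mul_invD (η : DiffS1) : η.D * η.invD = 1 := mul_inv η.D_mem_positive

/-- The derivation `f ↦ f_x / η_x` of `C^∞(S¹)`, conjugate to `∂ₓ` under composition
with `η`. -/
noncomputable def partialD (η : DiffS1) (f : SmoothFn) : SmoothFn := η.invD * f.D

theorem D_eq_mul_partialD (η : DiffS1) (f : SmoothFn) : f.D = η.D * η.partialD f := by
  rw [partialD, ← mul_assoc, D_mul_invD, one_mul]

theorem partialD_comp (η : DiffS1) (f : SmoothFn) : η.partialD (f.comp η) = f.D.comp η := by
  rw [partialD, D_comp, mul_comm, mul_assoc, D_mul_invD, mul_one]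

theorem D_comp_inv (η : DiffS1) (f : SmoothFn) : (f.comp η⁻¹).D = (η.partialD f).comp η⁻¹ := by
  rw [← comp_comp_inv (f.comp η⁻¹).D η, ← partialD_comp, comp_inv_comp]

variable (η : DiffS1)

theorem partialD_add (f g : SmoothFn) : η.partialD (f + g) = η.partialD f + η.partialD g := by
  simp only [partialD, D_add, mul_add]

theorem partialD_smul (c : ℝ) (f : SmoothFn) : η.partialD (c • f) = c • η.partialD f := by
  simp only [partialD, D_smul, mul_smul_comm]

theorem partialD_mul (f g : SmoothFn) :
    η.partialD (f * g) = η.partialD f * g + f * η.partialD g := by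
  simp only [partialD, SmoothFn.D_mul]; ring

/-- The derivation `f ↦ f_x / η_x` as a linear map. -/
noncomputable def partialDLinear : SmoothFn →ₗ[ℝ] SmoothFn where
  toFun := η.partialD
  map_add' := η.partialD_add
  map_smul' := η.partialD_smul

theorem partialD_sub (f g : SmoothFn) : η.partialD (f - g) = η.partialD f - η.partialD g :=
  map_sub η.partialDLinear f g

theorem partialD_neg (f : SmoothFn) : η.partialD (-f) = -η.partialD f :=
  map_neg η.partialDLinear f

/-- The integral `∫ f η_x dx`, that is `∫ f ∘ η⁻¹ dx`. -/
noncomputable def integral : SmoothFn →ₗ[ℝ] ℝ where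
  toFun f := integralS1 (f * η.D)
  map_add' f g := by rw [add_mul]; exact map_add integralCLM _ _
  map_smul' c f := by rw [smul_mul_assoc]; exact map_smul integralCLM _ _

theorem integral_apply (f : SmoothFn) : η.integral f = integralS1 (f * η.D) := rfl

theorem integral_comp (f : SmoothFn) : η.integral (f.comp η) = integralS1 f :=
  integralS1_comp_mul_D f η

theorem integral_partialD (f : SmoothFn) : η.integral (η.partialD f) = 0 := by
  rw [integral_apply, mul_comm, ← D_eq_mul_partialD, integralS1_D]

/-- Integration by parts in the form used throughout: an integral identity is reduced to a pointwise
one, the boundary terms being collected in `h`. -/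
theorem integral_eq_of_sub_eq {f g h : SmoothFn} (H : f - g = η.partialD h) :
    η.integral f = η.integral g := by
  rw [← sub_eq_zero, ← map_sub, H, integral_partialD]

end DiffS1

/-- The change of variables by `η` removes `η⁻¹`, so that the dependence on `η` is only through
`η_x` and can be differentiated in the chart. -/
theorem abMetric_eq (a b : ℝ) (η : DiffS1) (U V : SmoothFn) :
    abMetric a b η U V = η.integral (a • (U * V) + b • (η.partialD U * η.partialD V)) := by
  rw [DiffS1.integral_apply, ← SmoothFn.integralS1_comp_inv, abMetric, innerH1, DiffS1.D_comp_inv,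
    DiffS1.D_comp_inv]
  rfl

theorem semiMetric_eq (a b : ℝ) (p : SemiDiff) (X Y : SmoothFn × SmoothFn) :
    semiMetric a b p X Y = p.diffeo.integral (a • (X.1 * Y.1) + b • (X.2 * Y.2)) := by
  rw [DiffS1.integral_apply, ← SmoothFn.integralS1_comp_inv]
  rfl

/-! ## Velocities of curves -/

section Velocity

variable {F G : Type} [AddCommGroup F] [Module ℝ F] [TopologicalSpace F]
  [AddCommGroup G] [Module ℝ G] [TopologicalSpace G] {c d : ℝ → F} {v w : F}

theorem HasVelocity.congr (h : HasVelocity c v) (hcd : c =ᶠ[𝓝 0] d) : HasVelocity d v := by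
  refine Tendsto.congr' ?_ h
  filter_upwards [hcd.filter_mono nhdsWithin_le_nhds] with t ht
  rw [ht, hcd.self_of_nhds]

theorem hasVelocity_const (x : F) : HasVelocity (fun _ => x) (0 : F) := by
  simpa [HasVelocity] using tendsto_const_nhds

theorem hasVelocity_smul (v : F) : HasVelocity (fun t : ℝ => t • v) v := by
  refine Tendsto.congr' ?_ (tendsto_const_nhds (x := v))
  filter_upwards [self_mem_nhdsWithin] with t ht
  rw [zero_smul, sub_zero, smul_smul, inv_mul_cancel₀ ht, one_smul]

theorem hasVelocity_iff_hasDerivAt {c : ℝ → ℝ} {v : ℝ} : HasVelocity c v ↔ HasDerivAt c v 0 := by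
  rw [hasDerivAt_iff_tendsto_slope_zero, HasVelocity]
  simp only [zero_add]

theorem HasVelocity.clm (h : HasVelocity c v) (L : F →L[ℝ] G) :
    HasVelocity (fun t => L (c t)) (L v) := by
  have h1 := (L.continuous.tendsto v).comp h
  refine h1.congr fun t => ?_
  simp

theorem HasVelocity.prodMk {d : ℝ → G} {w : G} (h : HasVelocity c v) (h' : HasVelocity d w) :
    HasVelocity (fun t => (c t, d t)) (v, w) :=
  Tendsto.prodMk_nhds h h'

theorem HasVelocity.const_smul [ContinuousSMul ℝ F] (h : HasVelocity c v) (r : ℝ) :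
    HasVelocity (fun t => r • c t) (r • v) :=
  (Tendsto.const_smul h r).congr fun t => by rw [smul_comm, smul_sub]

variable [IsTopologicalAddGroup F]

theorem HasVelocity.add (h : HasVelocity c v) (h' : HasVelocity d w) :
    HasVelocity (fun t => c t + d t) (v + w) :=
  (Tendsto.add h h').congr fun t => by rw [← smul_add, add_sub_add_comm]

theorem HasVelocity.neg (h : HasVelocity c v) : HasVelocity (fun t => -c t) (-v) :=
  (Tendsto.neg h).congr fun t => by rw [← smul_neg, neg_sub, neg_sub_neg]

theorem HasVelocity.sub (h : HasVelocity c v) (h' : HasVelocity d w) :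
    HasVelocity (fun t => c t - d t) (v - w) := by
  simpa only [sub_eq_add_neg] using h.add h'.neg

theorem hasVelocity_add_smul (x v : F) : HasVelocity (fun t : ℝ => x + t • v) v := by
  simpa using (hasVelocity_const x).add (hasVelocity_smul v)

variable [ContinuousSMul ℝ F]

theorem HasVelocity.tendsto (h : HasVelocity c v) : Tendsto c (𝓝 0) (𝓝 (c 0)) := by
  rw [← nhdsNE_sup_pure, tendsto_sup]
  refine ⟨?_, tendsto_pure_nhds c 0⟩
  have h1 : Tendsto (fun t : ℝ => t) (𝓝[≠] 0) (𝓝 0) := tendsto_id.mono_left nhdsWithin_le_nhds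
  have h2 := (h1.smul h).const_add (c 0)
  rw [zero_smul, add_zero] at h2
  refine h2.congr' ?_
  filter_upwards [self_mem_nhdsWithin] with t ht
  rw [smul_smul, mul_inv_cancel₀ ht, one_smul, add_sub_cancel]

end Velocity

namespace SmoothFn

variable {c d : ℝ → SmoothFn} {v w : SmoothFn}

theorem hasVelocity_mul (h : HasVelocity c v) (h' : HasVelocity d w) :
    HasVelocity (fun t => c t * d t) (v * d 0 + c 0 * w) := by
  have h1 := h'.tendsto.mono_left (nhdsWithin_le_nhds (s := {0}ᶜ))
  refine (Tendsto.add (Tendsto.mul h h1) (Tendsto.const_mul (c 0) h')).congr fun t => ?_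
  rw [smul_mul_assoc, mul_smul_comm, ← smul_add]
  congr 1
  ring

theorem eventually_positive (h : HasVelocity c v) (hc : c 0 ∈ positive) :
    ∀ᶠ t in 𝓝 0, c t ∈ positive :=
  h.tendsto (isOpen_positive.mem_nhds hc)

theorem hasVelocity_inv (h : HasVelocity c v) (hc : c 0 ∈ positive) :
    HasVelocity (fun t => (c t).inv) (-((c 0).inv * (c 0).inv * v)) := by
  have h1 := tendsto_inv hc (h.tendsto.mono_left (nhdsWithin_le_nhds (s := {0}ᶜ)))
  refine (((h1.mul_const (c 0).inv).mul h).neg).congr' ?_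
  filter_upwards [(eventually_positive h hc).filter_mono nhdsWithin_le_nhds] with t ht
  rw [mul_smul_comm, ← smul_neg]
  congr 1
  -- The resolvent identity `1/f - 1/g = -(1/f)(1/g)(f - g)`.
  linear_combination (-(c 0).inv) * mul_inv ht + (c t).inv * mul_inv hc

/-- As for continuity, `tendsto_of_D` reduces the claim to the velocity of `f' / f`, given by the
product and inverse rules, and to the real logarithm at the point `0`. -/
theorem hasVelocity_log (h : HasVelocity c v) (hc : c 0 ∈ positive) :
    HasVelocity (fun t => (c t).log) ((c 0).inv * v) := by
  have hpos := eventually_positive h hc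
  refine tendsto_of_D ?_ ?_
  · have h1 : HasVelocity (fun t => (c t).log.D) _ :=
      (hasVelocity_mul (hasVelocity_inv h hc) (h.clm DCLM)).congr
        (hpos.mono fun t ht => (D_log ht).symm)
    have h2 : ((c 0).inv * v).D =
        -((c 0).inv * (c 0).inv * v) * DCLM (c 0) + (c 0).inv * DCLM v := by
      rw [D_mul, D_inv hc, DCLM_apply, DCLM_apply]; ring
    rw [h2]
    exact Tendsto.congr (fun t => by rw [D_smul, D_sub]) h1
  · let L : SmoothFn →L[ℝ] ℝ :=
      { toFun := fun f => f 0
        map_add' := fun _ _ => rfl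
        map_smul' := fun _ _ => rfl
        cont := continuous_eval 0 }
    have h1 := (hasVelocity_iff_hasDerivAt.1 (h.clm L)).log (hc 0).ne'
    have h2 := (hasVelocity_iff_hasDerivAt.2 h1).congr
      (d := fun t => (c t).log 0) (hpos.mono fun t ht => (log_apply ht 0).symm)
    rw [mul_apply, inv_apply hc, mul_comm, ← div_eq_mul_inv]
    exact h2

end SmoothFn

/-! ## Differential calculus of class `C^k` -/

section Bastiani

theorem isBastianiOn_clm : ∀ (k : ℕ) {E F : Type} [AddCommGroup E] [Module ℝ E]
    [TopologicalSpace E] [AddCommGroup F] [Module ℝ F] [TopologicalSpace F]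
    (L : E →L[ℝ] F) (s : Set E), IsBastianiOn k L s
  | 0, _, _, _, _, _, _, _, _, L, _ => L.continuous.continuousOn
  | k + 1, E, _, _, _, _, _, _, _, L, s => ⟨L.continuous.continuousOn,
      L.comp (ContinuousLinearMap.snd ℝ E E), fun x _ v => by
        refine Tendsto.congr' ?_ (tendsto_const_nhds (x := L v))
        filter_upwards [self_mem_nhdsWithin] with t ht
        simp [smul_smul, inv_mul_cancel₀ ht], isBastianiOn_clm k _ _⟩

theorem isBastianiOn_const : ∀ (k : ℕ) {E F : Type} [AddCommGroup E] [Module ℝ E]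
    [TopologicalSpace E] [AddCommGroup F] [Module ℝ F] [TopologicalSpace F]
    (y : F) (s : Set E), IsBastianiOn k (fun _ : E => y) s
  | 0, _, _, _, _, _, _, _, _, _, _ => continuousOn_const
  | k + 1, _, _, _, _, _, _, _, _, y, _ => ⟨continuousOn_const, fun _ => 0,
      fun _ _ _ => hasVelocity_const y, isBastianiOn_const k 0 _⟩

theorem IsBastianiOn.of_succ : ∀ {k : ℕ} {E F : Type} [AddCommGroup E] [Module ℝ E]
    [TopologicalSpace E] [AddCommGroup F] [Module ℝ F] [TopologicalSpace F] {f : E → F}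
    {s : Set E}, IsBastianiOn (k + 1) f s → IsBastianiOn k f s
  | 0, _, _, _, _, _, _, _, _, _, _, h => h.1
  | _ + 1, _, _, _, _, _, _, _, _, _, _, ⟨h, df, h1, h2⟩ => ⟨h, df, h1, h2.of_succ⟩

/-- The only chain rule on the inner side that is needed: the charts enter through the affine map `φ
↦ η_x + φ_x`. The differential is again a composition with an affine map, of `df` on the product,
which closes the induction. -/
theorem IsBastianiOn.comp_affine : ∀ {k : ℕ} {E E' F : Type} [AddCommGroup E] [Module ℝ E]
    [TopologicalSpace E] [IsTopologicalAddGroup E] [AddCommGroup E'] [Module ℝ E']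
    [TopologicalSpace E'] [AddCommGroup F] [Module ℝ F] [TopologicalSpace F] {f : E → F}
    {s : Set E}, IsBastianiOn k f s → ∀ (L : E' →L[ℝ] E) (y : E),
      IsBastianiOn k (fun x => f (y + L x)) ((fun x => y + L x) ⁻¹' s)
  | 0, _, _, _, _, _, _, _, _, _, _, _, _, _, _, _, h, L, _ =>
    ContinuousOn.comp h (continuous_const.add L.continuous).continuousOn fun _ hx => hx
  | k + 1, E, E', F, _, _, _, _, _, _, _, _, _, _, f, s, ⟨h, df, h1, h2⟩, L, y => by
    refine ⟨h.comp (continuous_const.add L.continuous).continuousOn fun _ hx => hx,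
      fun p => df (y + L p.1, L p.2), fun x hx v => ?_, ?_⟩
    · have := h1 _ hx (L v)
      simp only [map_add, map_smul, ← add_assoc]
      exact this
    · have h3 := h2.comp_affine (L.prodMap L) (y, 0)
      have h4 : (fun p : E' × E' => ((y, 0) : E × E) + L.prodMap L p) ⁻¹' s ×ˢ univ =
          ((fun x => y + L x) ⁻¹' s) ×ˢ univ := by
        ext p; simp
      have h5 : (fun p : E' × E' => df (y + L p.1, L p.2)) =
          fun p => df ((y, 0) + L.prodMap L p) :=
        funext fun p => congrArg df (Prod.ext rfl (zero_add _).symm)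
      rw [h4] at h3
      rw [h5]
      exact h3

theorem IsBastianiOn.comp_fst {k : ℕ} {E E' F : Type} [AddCommGroup E] [Module ℝ E]
    [TopologicalSpace E] [IsTopologicalAddGroup E] [AddCommGroup E'] [Module ℝ E']
    [TopologicalSpace E'] [AddCommGroup F] [Module ℝ F] [TopologicalSpace F] {f : E → F}
    {s : Set E} (h : IsBastianiOn k f s) :
    IsBastianiOn k (fun p : E × E' => f p.1) (s ×ˢ univ) := by
  have := h.comp_affine (ContinuousLinearMap.fst ℝ E E') 0
  simpa [prod_univ] using this

theorem IsBastianiOn.prodMk : ∀ {k : ℕ} {E F G : Type} [AddCommGroup E] [Module ℝ E]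
    [TopologicalSpace E] [AddCommGroup F] [Module ℝ F] [TopologicalSpace F] [AddCommGroup G]
    [Module ℝ G] [TopologicalSpace G] {f : E → F} {g : E → G} {s : Set E}, IsBastianiOn k f s →
      IsBastianiOn k g s → IsBastianiOn k (fun x => (f x, g x)) s
  | 0, _, _, _, _, _, _, _, _, _, _, _, _, _, _, _, h, h' => ContinuousOn.prodMk h h'
  | _ + 1, _, _, _, _, _, _, _, _, _, _, _, _, _, _, _, ⟨h, df, h1, h2⟩, ⟨h', dg, h1', h2'⟩ =>
    ⟨h.prodMk h', fun p => (df p, dg p), fun x hx v => (h1 x hx v).prodMk (h1' x hx v),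
      h2.prodMk h2'⟩

theorem IsBastianiOn.clm : ∀ {k : ℕ} {E F G : Type} [AddCommGroup E] [Module ℝ E]
    [TopologicalSpace E] [AddCommGroup F] [Module ℝ F] [TopologicalSpace F] [AddCommGroup G]
    [Module ℝ G] [TopologicalSpace G] {f : E → F} {s : Set E}, IsBastianiOn k f s →
      ∀ L : F →L[ℝ] G, IsBastianiOn k (fun x => L (f x)) s
  | 0, _, _, _, _, _, _, _, _, _, _, _, _, _, _, h, L => L.continuous.comp_continuousOn h
  | _ + 1, _, _, _, _, _, _, _, _, _, _, _, _, _, _, ⟨h, df, h1, h2⟩, L =>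
    ⟨L.continuous.comp_continuousOn h, fun p => L (df p), fun x hx v => (h1 x hx v).clm L,
      h2.clm L⟩

theorem IsBastianiOn.add {k : ℕ} {E F : Type} [AddCommGroup E] [Module ℝ E]
    [TopologicalSpace E] [AddCommGroup F] [Module ℝ F] [TopologicalSpace F]
    [IsTopologicalAddGroup F] {f g : E → F} {s : Set E} (h : IsBastianiOn k f s)
    (h' : IsBastianiOn k g s) : IsBastianiOn k (fun x => f x + g x) s :=
  (h.prodMk h').clm (ContinuousLinearMap.fst ℝ F F + ContinuousLinearMap.snd ℝ F F)

theorem IsBastianiOn.neg {k : ℕ} {E F : Type} [AddCommGroup E] [Module ℝ E]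
    [TopologicalSpace E] [AddCommGroup F] [Module ℝ F] [TopologicalSpace F]
    [IsTopologicalAddGroup F] {f : E → F} {s : Set E} (h : IsBastianiOn k f s) :
    IsBastianiOn k (fun x => -f x) s :=
  h.clm (-ContinuousLinearMap.id ℝ F)

theorem IsBastianiOn.sub {k : ℕ} {E F : Type} [AddCommGroup E] [Module ℝ E]
    [TopologicalSpace E] [AddCommGroup F] [Module ℝ F] [TopologicalSpace F]
    [IsTopologicalAddGroup F] {f g : E → F} {s : Set E} (h : IsBastianiOn k f s)
    (h' : IsBastianiOn k g s) : IsBastianiOn k (fun x => f x - g x) s := by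
  simpa only [sub_eq_add_neg] using h.add h'.neg

/-- The differential `df g + f dg` is again a sum of products; the undifferentiated factors lose one
order and are pulled back along the first projection. -/
theorem IsBastianiOn.mul : ∀ {k : ℕ} {E : Type} [AddCommGroup E] [Module ℝ E]
    [TopologicalSpace E] [IsTopologicalAddGroup E] {f g : E → SmoothFn} {s : Set E},
    IsBastianiOn k f s → IsBastianiOn k g s → IsBastianiOn k (fun x => f x * g x) s
  | 0, _, _, _, _, _, _, _, _, h, h' => ContinuousOn.mul h h'
  | _ + 1, _, _, _, _, _, f, g, _, H@⟨h, df, h1, h2⟩, H'@⟨h', dg, h1', h2'⟩ =>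
    ⟨h.mul h', fun p => df p * g p.1 + f p.1 * dg p,
      fun x hx v => by simpa using SmoothFn.hasVelocity_mul (h1 x hx v) (h1' x hx v),
      (h2.mul H'.of_succ.comp_fst).add (H.of_succ.comp_fst.mul h2')⟩

namespace SmoothFn

/-- The differential `-(1/f)² v` is a polynomial in inversion itself, so the class `C^k` passes to
`C^(k+1)`. -/
theorem isBastianiOn_inv (k : ℕ) : IsBastianiOn k inv positive := by
  have h0 : ContinuousOn inv positive := fun f hf =>
    tendsto_inv hf (tendsto_id.mono_left nhdsWithin_le_nhds)
  induction k with
  | zero => exact h0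
  | succ k ih =>
    refine ⟨h0, fun p => -(p.1.inv * p.1.inv * p.2), fun x hx v => ?_, ?_⟩
    · simpa using hasVelocity_inv (hasVelocity_add_smul x v) (by simpa using hx)
    · exact ((ih.comp_fst.mul ih.comp_fst).mul
        (isBastianiOn_clm k (ContinuousLinearMap.snd ℝ SmoothFn SmoothFn) _)).neg

theorem isBastianiOn_log (k : ℕ) : IsBastianiOn k log positive := by
  have h0 : ContinuousOn log positive := fun f hf =>
    tendsto_log hf (tendsto_id.mono_left nhdsWithin_le_nhds)
  cases k with
  | zero => exact h0
  | succ k =>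
    refine ⟨h0, fun p => p.1.inv * p.2, fun x hx v => ?_, ?_⟩
    · simpa using hasVelocity_log (hasVelocity_add_smul x v) (by simpa using hx)
    · exact (isBastianiOn_inv k).comp_fst.mul
        (isBastianiOn_clm k (ContinuousLinearMap.snd ℝ SmoothFn SmoothFn) _)

end SmoothFn

theorem hasTangentMapAt_of_clm {M M' E E' : Type}
    [AddCommGroup E] [Module ℝ E] [TopologicalSpace E]
    [AddCommGroup E'] [Module ℝ E'] [TopologicalSpace E'] {τ : M → E → M} {τ' : M' → E' → M'}
    {f : M → M'} {p : M} (L : E →L[ℝ] E') (h : ∀ v, f (τ p v) = τ' (f p) (L v)) :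
    HasTangentMapAt τ τ' f p L :=
  ⟨univ, L, ⟨isOpen_univ, mem_univ _, map_zero L, fun k => isBastianiOn_clm k L _, fun v _ => h v⟩,
    fun v => (hasVelocity_smul v).clm L⟩

end Bastiani

/-! ## Right invariance of the metrics -/

theorem isRightInvariant_abMetric (a b : ℝ) :
    IsRightInvariant DiffS1.translate (abMetric a b) := fun p q => by
  refine ⟨SmoothFn.compCLM q, hasTangentMapAt_of_clm _ fun v => p.translate_mul q v,
    fun U V => ?_⟩
  have h : q * (p * q)⁻¹ = p⁻¹ := by group
  simp only [abMetric, SmoothFn.compCLM_apply, SmoothFn.comp_comp, h]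

theorem isRightInvariant_semiMetric (a b : ℝ) :
    IsRightInvariant SemiDiff.translate (semiMetric a b) := fun p q => by
  refine ⟨(SmoothFn.compCLM q.diffeo).prodMap (SmoothFn.compCLM q.diffeo),
    hasTangentMapAt_of_clm _ fun v => SemiDiff.ext (p.diffeo.translate_mul q.diffeo v.1) ?_,
    fun U V => ?_⟩
  · exact add_right_comm (p.func.comp q.diffeo) (v.2.comp q.diffeo) q.func
  · have h : q.diffeo * (p * q).diffeo⁻¹ = p.diffeo⁻¹ := by
      change q.diffeo * (p.diffeo * q.diffeo)⁻¹ = p.diffeo⁻¹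
      group
    have hc : ∀ f : SmoothFn,
        (SmoothFn.compCLM q.diffeo f).comp (p * q).diffeo⁻¹ = f.comp p.diffeo⁻¹ := fun f => by
      rw [SmoothFn.compCLM_apply, SmoothFn.comp_comp, h]
    change innerL2 a b ((SmoothFn.compCLM q.diffeo U.1).comp _,
      (SmoothFn.compCLM q.diffeo U.2).comp _) ((SmoothFn.compCLM q.diffeo V.1).comp _,
      (SmoothFn.compCLM q.diffeo V.2).comp _) = _
    simp only [hc]
    rfl

/-! ## The embedding `Υ` -/

open SmoothFn

theorem Upsilon_mul (η ξ : DiffS1) : Upsilon (η * ξ) = Upsilon η * Upsilon ξ :=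
  SemiDiff.ext rfl <| SmoothFn.ext fun x => by
    change (η * ξ).logD x = η.logD (ξ x) + ξ.logD x
    rw [DiffS1.logD_apply, DiffS1.logD_apply, DiffS1.logD_apply, DiffS1.D_mul, mul_apply,
      comp_apply, Real.log_mul (η.D_mem_positive _).ne' (ξ.D_mem_positive _).ne']

namespace DiffS1

theorem continuous_D : Continuous DiffS1.D :=
  continuous_snd.comp (continuous_induced_dom (f := fun η : DiffS1 =>
    ((⟨η, η.continuous⟩ : C(UnitAddCircle, UnitAddCircle)), η.D)))

theorem continuous_logD : Continuous logD := by
  simp only [funext logD_eq]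
  exact continuous_iff_continuousAt.2 fun η =>
    tendsto_log η.D_mem_positive (continuous_D.tendsto η)

end DiffS1

/-- The projection to `Diff(S¹)` is a continuous left inverse of `Υ`. -/
theorem isEmbedding_Upsilon : IsEmbedding Upsilon := by
  have h1 : IsInducing fun p : SemiDiff => (p.diffeo, p.func) := ⟨rfl⟩
  have h2 : Continuous SemiDiff.diffeo := continuous_fst.comp h1.continuous
  have h3 : Continuous Upsilon :=
    h1.continuous_iff.2 (continuous_id.prodMk DiffS1.continuous_logD)
  exact Function.LeftInverse.isEmbedding (f := SemiDiff.diffeo) (fun η => rfl) h2 h3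

namespace DiffS1

variable (η : DiffS1)

/-- The functions `φ` with `η_x + φ_x > 0`: the domain of the chart at `η`. -/
def chartDomain : Set SmoothFn := {φ | η.D + φ.D ∈ positive}

theorem isOpen_chartDomain : IsOpen η.chartDomain :=
  isOpen_positive.preimage (continuous_const.add SmoothFn.continuous_D)

theorem zero_mem_chartDomain : (0 : SmoothFn) ∈ η.chartDomain := by
  change η.D + SmoothFn.D 0 ∈ positive
  rw [D_zero, add_zero]
  exact η.D_mem_positive

/-- The map `φ ↦ ln (η_x + φ_x) - ln η_x`. -/
noncomputable def logIncrement (φ : SmoothFn) : SmoothFn := (η.D + φ.D).log - η.D.log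

theorem logIncrement_zero : η.logIncrement 0 = 0 := by
  rw [logIncrement, D_zero, add_zero, sub_self]

theorem isBastianiOn_logIncrement (k : ℕ) : IsBastianiOn k η.logIncrement η.chartDomain :=
  ((isBastianiOn_log k).comp_affine DCLM η.D).sub (isBastianiOn_const k η.D.log _)

theorem hasVelocity_logIncrement (v : SmoothFn) :
    HasVelocity (fun t : ℝ => η.logIncrement (t • v)) (η.partialD v) := by
  have h1 := hasVelocity_add_smul η.D v.D
  have h2 := (hasVelocity_log h1 (by simpa using η.D_mem_positive)).sub
    (hasVelocity_const η.D.log)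
  simp only [zero_smul, add_zero, sub_zero] at h2
  simp only [logIncrement, D_smul]
  exact h2

/-- The derivation `f ↦ f_x / η_x` as a continuous linear map. -/
noncomputable def partialDCLM : SmoothFn →L[ℝ] SmoothFn :=
  ⟨η.partialDLinear, continuous_const.mul SmoothFn.continuous_D⟩

/-- The shear `(φ, K) ↦ (φ, K - ln (η_x + φ_x) + ln η_x)`. -/
noncomputable def shear : OpenPartialHomeomorph (SmoothFn × SmoothFn) (SmoothFn × SmoothFn) where
  toFun X := (X.1, X.2 - η.logIncrement X.1)
  invFun X := (X.1, X.2 + η.logIncrement X.1)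
  source := η.chartDomain ×ˢ univ
  target := η.chartDomain ×ˢ univ
  map_source' _ h := ⟨h.1, trivial⟩
  map_target' _ h := ⟨h.1, trivial⟩
  left_inv' _ _ := Prod.ext rfl (sub_add_cancel _ _)
  right_inv' _ _ := Prod.ext rfl (add_sub_cancel_right _ _)
  open_source := η.isOpen_chartDomain.prod isOpen_univ
  open_target := η.isOpen_chartDomain.prod isOpen_univ
  continuousOn_toFun := continuousOn_fst.prodMk
    (continuousOn_snd.sub (η.isBastianiOn_logIncrement 0).comp_fst)
  continuousOn_invFun := continuousOn_fst.prodMk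
    (continuousOn_snd.add (η.isBastianiOn_logIncrement 0).comp_fst)

theorem isLocalRep_Upsilon : IsLocalRep translate SemiDiff.translate Upsilon η η.chartDomain
    fun φ => (φ, η.logIncrement φ) := by
  refine ⟨η.isOpen_chartDomain, η.zero_mem_chartDomain, Prod.ext rfl η.logIncrement_zero,
    fun k => (isBastianiOn_clm k (ContinuousLinearMap.id ℝ SmoothFn) _).prodMk
      (η.isBastianiOn_logIncrement k), fun φ hφ => SemiDiff.ext rfl ?_⟩
  change (η.translate φ).logD = η.logD + η.logIncrement φ
  rw [logD_eq, logD_eq, D_translate hφ, logIncrement, add_sub_cancel]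

/-- In charts `Υ` is the graph of `logIncrement`; `shear` flattens it to the first factor, which is
complemented by the second. -/
theorem isImmersionAt_Upsilon : IsImmersionAt translate SemiDiff.translate Upsilon η := by
  have h (k : ℕ) := isBastianiOn_clm k (ContinuousLinearMap.fst ℝ SmoothFn SmoothFn)
    (η.chartDomain ×ˢ univ)
  have h' (k : ℕ) := isBastianiOn_clm k (ContinuousLinearMap.snd ℝ SmoothFn SmoothFn)
    (η.chartDomain ×ˢ univ)
  refine ⟨η.chartDomain, _, η.isLocalRep_Upsilon, η.shear, ⟨η.zero_mem_chartDomain, trivial⟩,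
    ?_, fun k => (h k).prodMk ((h' k).sub (η.isBastianiOn_logIncrement k).comp_fst),
    fun k => (h k).prodMk ((h' k).add (η.isBastianiOn_logIncrement k).comp_fst),
    ContinuousLinearMap.inl ℝ SmoothFn SmoothFn, ContinuousLinearMap.fst ℝ SmoothFn SmoothFn,
    fun v => rfl, fun v hv => ⟨⟨hv, trivial⟩, Prod.ext rfl (sub_self _)⟩⟩
  exact Prod.ext rfl (by
    change (0 : SmoothFn) - η.logIncrement 0 = 0
    rw [logIncrement_zero, sub_zero])

/-- The tangent map `U ↦ (U, U_x / η_x)` of `Υ` at `η`. -/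
noncomputable def tangentUpsilon : SmoothFn →L[ℝ] SmoothFn × SmoothFn :=
  (ContinuousLinearMap.id ℝ SmoothFn).prod η.partialDCLM

theorem tangentUpsilon_apply (U : SmoothFn) : η.tangentUpsilon U = (U, η.partialD U) := rfl

theorem hasTangentMapAt_Upsilon :
    HasTangentMapAt translate SemiDiff.translate Upsilon η η.tangentUpsilon :=
  ⟨_, _, η.isLocalRep_Upsilon, fun v => (hasVelocity_smul v).prodMk (η.hasVelocity_logIncrement v)⟩

theorem tangentUpsilon_comp (u : SmoothFn) :
    η.tangentUpsilon (u.comp η) = (u.comp η, u.D.comp η) := by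
  rw [tangentUpsilon_apply, partialD_comp]

end DiffS1

theorem isSmoothEmbedding_Upsilon :
    IsSmoothEmbedding DiffS1.translate SemiDiff.translate Upsilon :=
  ⟨isEmbedding_Upsilon, DiffS1.isImmersionAt_Upsilon⟩

theorem semiMetric_Upsilon (a b : ℝ) (η : DiffS1) (U V : SmoothFn) :
    semiMetric a b (Upsilon η) (η.tangentUpsilon U) (η.tangentUpsilon V) = abMetric a b η U V := by
  rw [semiMetric_eq, abMetric_eq]; rfl

/-! ## The operator `A` and its conjugates -/

namespace SmoothFn

/-- The first order periodic equation `f' + c f = h` has a smooth solution. -/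
theorem exists_D_add_smul_eq {c : ℝ} (hc : c ≠ 0) (h : SmoothFn) :
    ∃ f : SmoothFn, f.D + c • f = h := by
  have hc1 : Real.exp c - 1 ≠ 0 := sub_ne_zero.2 fun h1 => hc (by simpa using h1)
  let g : ℝ → ℝ := fun x => Real.exp (c * x) * h (x : UnitAddCircle)
  have hg : ContDiff ℝ ∞ g :=
    (Real.contDiff_exp.comp (contDiff_const.mul contDiff_id)).mul h.contDiff
  let P : ℝ → ℝ := fun x => ∫ y in (0 : ℝ)..x, g y
  have hP : ∀ x, HasDerivAt P (g x) x := fun x =>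
    hg.continuous.integral_hasStrictDerivAt 0 x |>.hasDerivAt
  have hPs : ContDiff ℝ ∞ P := by
    refine contDiff_infty_iff_deriv.2 ⟨fun x => (hP x).differentiableAt, ?_⟩
    rw [funext fun x => (hP x).deriv]
    exact hg
  have hg1 : ∀ x, g (x + 1) = Real.exp c * g x := fun x => by
    have := h.periodic x
    simp only [g] at this ⊢
    rw [this, mul_add, mul_one, Real.exp_add]; ring
  -- Both terms have the same derivative, since the integrand is multiplied by `exp c` over one
  -- period; the constant is the value at `0`.
  have hP1 : ∀ x, P (x + 1) - Real.exp c * P x = P 1 := by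
    have hd : ∀ x, HasDerivAt (fun x => P (x + 1) - Real.exp c * P x) 0 x := fun x => by
      have := ((hP (x + 1)).comp_add_const x 1).sub ((hP x).const_mul (Real.exp c))
      rwa [hg1, sub_self] at this
    intro x
    have := is_const_of_deriv_eq_zero (fun x => (hd x).differentiableAt) (fun x => (hd x).deriv) x 0
    simpa [P] using this
  -- Variation of constants. The added constant is the one making `F` periodic, and it exists
  -- because `exp c ≠ 1`.
  let F : ℝ → ℝ := fun x => Real.exp (-(c * x)) * (P x + P 1 / (Real.exp c - 1))
  have hF : ContDiff ℝ ∞ F :=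
    (Real.contDiff_exp.comp (contDiff_const.mul contDiff_id).neg).mul (hPs.add contDiff_const)
  have hF1 : Function.Periodic F 1 := fun x => by
    have h1 : P (x + 1) = Real.exp c * P x + P 1 := by linarith [hP1 x]
    simp only [F]
    rw [h1, show -(c * (x + 1)) = -(c * x) + -c by ring, Real.exp_add, Real.exp_neg c]
    have := Real.exp_ne_zero c
    field_simp
    ring
  have hFd : ∀ x : ℝ, HasDerivAt F (h (x : UnitAddCircle) - c * F x) x := fun x => by
    have h1 : HasDerivAt (fun x : ℝ => Real.exp (-(c * x))) _ x :=
      (((hasDerivAt_id x).const_mul c).neg).exp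
    refine (h1.mul ((hP x).add_const (P 1 / (Real.exp c - 1)))).congr_deriv ?_
    have h2 : Real.exp (-(c * x)) * Real.exp (c * x) = 1 := by
      rw [← Real.exp_add, neg_add_cancel, Real.exp_zero]
    simp only [F, g, id]
    linear_combination h (x : UnitAddCircle) * h2
  refine ⟨ofPeriodic F hF hF1, ?_⟩
  rw [D_eq_of_hasDerivAt (g := h - c • ofPeriodic F hF hF1) hFd, sub_add_cancel]

end SmoothFn

namespace DiffS1

variable (η : DiffS1)

/-- The operator `a - b ∂²`, where `∂ f = f_x / η_x`. -/
noncomputable def opA (a b : ℝ) : SmoothFn →ₗ[ℝ] SmoothFn :=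
  a • LinearMap.id - b • (η.partialDLinear ∘ₗ η.partialDLinear)

theorem opA_apply (a b : ℝ) (f : SmoothFn) :
    η.opA a b f = a • f - b • η.partialD (η.partialD f) := rfl

theorem opA_comp (a b : ℝ) (f : SmoothFn) :
    η.opA a b (f.comp η) = (CircleGeometry.opA a b f).comp η := by
  rw [opA_apply, partialD_comp, partialD_comp]; rfl

theorem opA_partialD (a b : ℝ) (f : SmoothFn) :
    η.opA a b (η.partialD f) = η.partialD (η.opA a b f) := by
  rw [opA_apply, opA_apply, partialD_sub, partialD_smul, partialD_smul]

/-- The factorization of `a - b ∂²` into first order operators. -/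
theorem opA_eq_factors {a b c : ℝ} (hc : b * c ^ 2 = a) (f : SmoothFn) :
    η.opA a b f = -b • (η.partialD (η.partialD f + c • f) - c • (η.partialD f + c • f)) := by
  rw [opA_apply, partialD_add, partialD_smul, ← hc]
  refine SmoothFn.ext fun x => ?_
  simp only [sub_apply, add_apply, smul_apply]
  ring

variable {a b : ℝ}

theorem exists_pos_mul_sq_eq (ha : 0 < a) (hb : 0 < b) : ∃ c : ℝ, 0 < c ∧ b * c ^ 2 = a :=
  ⟨√(a / b), by positivity, by rw [Real.sq_sqrt (by positivity)]; field_simp⟩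

theorem D_eq_of_partialD_add_smul {c : ℝ} {f h : SmoothFn} (hf : η.partialD f + c • f = h) :
    f.D = η.D * (h - c • f) := by
  rw [← hf, add_sub_cancel_right, ← D_eq_mul_partialD]

/-- The operators `A⁻¹` are uniformly continuous at `0` along convergent curves. -/
theorem tendsto_zero_of_opA {ι : Type*} {l : Filter ι} {η : ι → DiffS1} {F : ι → SmoothFn}
    {e : SmoothFn} (ha : 0 < a) (hb : 0 < b) (hη : Tendsto (fun t => (η t).D) l (𝓝 e))
    (h : Tendsto (fun t => (η t).opA a b (F t)) l (𝓝 0)) : Tendsto F l (𝓝 0) := by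
  obtain ⟨c, hc, hcab⟩ := exists_pos_mul_sq_eq ha hb
  have hne : ∀ t x, (η t).D x ≠ 0 := fun t x => ((η t).D_mem_positive x).ne'
  have h1 : Tendsto (fun t => (η t).partialD (F t) + c • F t) l (𝓝 0) := by
    -- The outer factor `∂ - c` is undone first, giving convergence of `∂F + c F`; the inner factor
    -- `∂ + c` follows.
    refine tendsto_zero_of_D_eq (c := -c) (neg_ne_zero.2 hc.ne') hη hne
      (H := fun t => (-b)⁻¹ • (η t).opA a b (F t)) ?_ fun t => ?_
    · simpa using h.const_smul (-b)⁻¹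
    · refine D_eq_of_partialD_add_smul _ ?_
      rw [(η t).opA_eq_factors hcab, smul_smul, inv_mul_cancel₀ (neg_ne_zero.2 hb.ne'), one_smul,
        neg_smul, sub_eq_add_neg]
  exact tendsto_zero_of_D_eq hc.ne' hη hne h1 fun t => D_eq_of_partialD_add_smul _ rfl

theorem bijective_opA (ha : 0 < a) (hb : 0 < b) : Function.Bijective (η.opA a b) := by
  constructor
  · refine (injective_iff_map_eq_zero (η.opA a b)).2 fun f hf => ?_
    -- Injectivity is the convergence statement for a constant family: a kernel element `f` tends to
    -- `0`, hence is `0` as limits are unique.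
    have h := tendsto_zero_of_opA (l := (⊤ : Filter Unit)) (η := fun _ => η) (F := fun _ => f)
      ha hb tendsto_const_nhds (by rw [hf]; exact tendsto_const_nhds)
    exact tendsto_nhds_unique tendsto_const_nhds h
  · intro h
    obtain ⟨c, hc, hcab⟩ := exists_pos_mul_sq_eq ha hb
    -- The two factors are inverted in succession, at the identity; composition with `η` carries the
    -- solution over.
    obtain ⟨g, hg⟩ := exists_D_add_smul_eq (neg_ne_zero.2 hc.ne') ((-b)⁻¹ • h.comp η⁻¹)
    obtain ⟨f, hf⟩ := exists_D_add_smul_eq hc.ne' g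
    refine ⟨f.comp η, ?_⟩
    rw [η.opA_eq_factors hcab, partialD_comp, ← smul_comp, ← add_comp, hf, partialD_comp,
      ← smul_comp, ← sub_comp, sub_eq_add_neg, ← neg_smul, hg, smul_comp, smul_smul,
      mul_inv_cancel₀ (neg_ne_zero.2 hb.ne'), one_smul, comp_inv_comp]

open Classical in
/-- The inverse of `a - b ∂²`, where `∂ f = f_x / η_x`, for `a, b > 0`. -/
noncomputable def opAInv (a b : ℝ) : SmoothFn →ₗ[ℝ] SmoothFn :=
  if h : Function.Bijective (η.opA a b) then (LinearEquiv.ofBijective _ h).symm else 0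

theorem opA_opAInv (ha : 0 < a) (hb : 0 < b) (f : SmoothFn) :
    η.opA a b (η.opAInv a b f) = f := by
  rw [opAInv, dif_pos (η.bijective_opA ha hb)]
  exact (LinearEquiv.ofBijective _ (η.bijective_opA ha hb)).apply_symm_apply f

theorem opAInv_eq (ha : 0 < a) (hb : 0 < b) {f g : SmoothFn} (h : η.opA a b f = g) :
    η.opAInv a b g = f :=
  (η.bijective_opA ha hb).1 ((η.opA_opAInv ha hb g).trans h.symm)

end DiffS1

theorem bijective_opA {a b : ℝ} (ha : 0 < a) (hb : 0 < b) : Function.Bijective (opA a b) := by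
  have h : opA a b = DiffS1.opA 1 a b := funext fun f => ((1 : DiffS1).opA_comp a b f).symm
  rw [h]
  exact DiffS1.bijective_opA 1 ha hb

theorem opA_opAinv {a b : ℝ} (ha : 0 < a) (hb : 0 < b) (f : SmoothFn) :
    opA a b (opAinv a b f) = f :=
  Function.rightInverse_invFun (bijective_opA ha hb).2 f

open SmoothFn

namespace DiffS1

variable (η : DiffS1)

/-! ## Velocities along the curves `η + t U` -/

section Velocity

variable {η} {c : ℝ → SmoothFn} {v : SmoothFn}

theorem hasVelocity_D (η : DiffS1) (U : SmoothFn) :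
    HasVelocity (fun t : ℝ => (η.translate (t • U)).D) U.D := by
  have h := hasVelocity_add_smul η.D U.D
  refine h.congr ?_
  filter_upwards [eventually_positive h (by simpa using η.D_mem_positive)] with t ht
  rw [D_translate (by rwa [D_smul]), D_smul]

theorem hasVelocity_partialD (h : HasVelocity c v) (U : SmoothFn) :
    HasVelocity (fun t : ℝ => (η.translate (t • U)).partialD (c t))
      (η.partialD v - η.partialD U * η.partialD (c 0)) := by
  have h1 := hasVelocity_mul (hasVelocity_inv (hasVelocity_D η U) (D_mem_positive _)) (h.clm DCLM)
  simp only [zero_smul, translate_zero] at h1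
  have h2 : η.partialD v - η.partialD U * η.partialD (c 0) =
      -(η.D.inv * η.D.inv * U.D) * DCLM (c 0) + η.D.inv * DCLM v := by
    simp only [partialD, invD, DCLM_apply]; ring
  rw [h2]
  exact h1

theorem hasVelocity_partialD_const (η : DiffS1) (f U : SmoothFn) :
    HasVelocity (fun t : ℝ => (η.translate (t • U)).partialD f)
      (-(η.partialD U * η.partialD f)) := by
  simpa [partialD, D_zero] using hasVelocity_partialD (η := η) (hasVelocity_const f) U

theorem hasDerivAt_integral (h : HasVelocity c v) (U : SmoothFn) :
    HasDerivAt (fun t : ℝ => (η.translate (t • U)).integral (c t))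
      (η.integral (v + η.partialD U * c 0)) 0 := by
  have h1 := (hasVelocity_mul h (hasVelocity_D η U)).clm integralCLM
  simp only [zero_smul, translate_zero] at h1
  have h2 : η.integral (v + η.partialD U * c 0) = integralCLM (v * η.D + c 0 * U.D) := by
    rw [integral_apply, integralCLM_apply, η.D_eq_mul_partialD U]
    congr 1
    ring
  rw [h2]
  exact hasVelocity_iff_hasDerivAt.1 h1

theorem hasVelocity_opA (η : DiffS1) (a b : ℝ) (f U : SmoothFn) :
    HasVelocity (fun t : ℝ => (η.translate (t • U)).opA a b f)
      (b • (η.partialD U * η.partialD (η.partialD f) +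
        η.partialD (η.partialD U * η.partialD f))) := by
  have h1 := hasVelocity_partialD (η := η) (hasVelocity_partialD_const η f U) U
  simp only [zero_smul, translate_zero] at h1
  have h2 := (hasVelocity_const (a • f)).sub (h1.const_smul b)
  have h3 : b • (η.partialD U * η.partialD (η.partialD f) +
        η.partialD (η.partialD U * η.partialD f)) =
      0 - b • (η.partialD (-(η.partialD U * η.partialD f)) -
        η.partialD U * η.partialD (η.partialD f)) := by
    rw [partialD_neg, zero_sub, ← smul_neg]
    congr 1
    ring
  rw [h3]
  exact h2

/-- Implicit differentiation. Put `g = A₀⁻¹ c(0)`. Applying `A_t` to the difference quotient gives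
`(c(t) - A_t g) / t`, which tends to `w = v - Ȧ g`; also `A_t (A₀⁻¹ w)` tends to `w`. So `A_t` sends
the difference between the quotient and `A₀⁻¹ w` to a family tending to `0`, and
`tendsto_zero_of_opA` removes `A_t`. -/
theorem hasVelocity_opAInv {a b : ℝ} (ha : 0 < a) (hb : 0 < b) (h : HasVelocity c v)
    (U : SmoothFn) : HasVelocity (fun t : ℝ => (η.translate (t • U)).opAInv a b (c t))
      (η.opAInv a b (v - b • (η.partialD U * η.partialD (η.partialD (η.opAInv a b (c 0))) +
        η.partialD (η.partialD U * η.partialD (η.opAInv a b (c 0)))))) := by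
  have h1 := h.sub (hasVelocity_opA η a b (η.opAInv a b (c 0)) U)
  set g := η.opAInv a b (c 0) with hg
  set w := v - b • (η.partialD U * η.partialD (η.partialD g) +
        η.partialD (η.partialD U * η.partialD g))
  have h0 : c 0 - η.opA a b g = 0 := by rw [hg, opA_opAInv η ha hb, sub_self]
  have h2 := (hasVelocity_opA η a b (η.opAInv a b w) U).tendsto.mono_left
    (nhdsWithin_le_nhds (s := {0}ᶜ))
  simp only [zero_smul, translate_zero, opA_opAInv η ha hb] at h2
  have h3 := Tendsto.sub h1 h2
  simp only [zero_smul, translate_zero, h0, sub_zero, sub_self] at h3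
  have h4 : Tendsto (fun t : ℝ => (η.translate (t • U)).D) (𝓝[≠] 0)
      (𝓝 (η.translate ((0 : ℝ) • U)).D) :=
    (hasVelocity_D η U).tendsto.mono_left nhdsWithin_le_nhds
  refine tendsto_sub_nhds_zero_iff.1 (tendsto_zero_of_opA ha hb h4 (h3.congr fun t => ?_))
  simp only [zero_smul, translate_zero, map_sub, map_smul, opA_opAInv _ ha hb]
  rfl

end Velocity

/-! ## The Levi-Civita connection and the curvature of `Diff(S¹)` -/

/-- The bilinear map `a U V + (b / 2) ∂U ∂V`, where `∂ f = f_x / η_x`. -/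
noncomputable def bilin (a b : ℝ) : SmoothFn →ₗ[ℝ] SmoothFn →ₗ[ℝ] SmoothFn :=
  a • LinearMap.mul ℝ SmoothFn +
    (b / 2) • (LinearMap.mul ℝ SmoothFn).compl₁₂ η.partialDLinear η.partialDLinear

theorem bilin_apply (a b : ℝ) (U V : SmoothFn) :
    η.bilin a b U V = a • (U * V) + (b / 2) • (η.partialD U * η.partialD V) := rfl

/-- The Christoffel map of the `a`-`b` metric. -/
noncomputable def christoffel (a b : ℝ) : SmoothFn →ₗ[ℝ] SmoothFn →ₗ[ℝ] SmoothFn :=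
  (η.bilin a b).compr₂ (η.opAInv a b ∘ₗ η.partialDLinear)

theorem christoffel_apply (a b : ℝ) (U V : SmoothFn) :
    η.christoffel a b U V = η.opAInv a b (η.partialD (η.bilin a b U V)) := rfl

theorem christoffel_comm (a b : ℝ) (U V : SmoothFn) :
    η.christoffel a b U V = η.christoffel a b V U := by
  rw [christoffel_apply, christoffel_apply, bilin_apply, bilin_apply, mul_comm U,
    mul_comm (η.partialD U)]

/-- The velocity of `christoffel a b V W` along `η + t U`. -/
noncomputable def christoffelDeriv (a b : ℝ) (U V W : SmoothFn) : SmoothFn :=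
  η.opAInv a b (η.partialD (-(b • (η.partialD U * η.partialD V * η.partialD W))) -
    η.partialD U * η.partialD (η.bilin a b V W) -
    b • (η.partialD U * η.partialD (η.partialD (η.christoffel a b V W)) +
      η.partialD (η.partialD U * η.partialD (η.christoffel a b V W))))

/-- The curvature tensor of the `a`-`b` metric. -/
noncomputable def curvature (a b : ℝ) (U V W : SmoothFn) : SmoothFn :=
  (η.christoffelDeriv a b U V W + η.christoffel a b U (η.christoffel a b V W)) -
    (η.christoffelDeriv a b V U W + η.christoffel a b V (η.christoffel a b U W))

variable {a b : ℝ}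

theorem opA_christoffel (ha : 0 < a) (hb : 0 < b) (U V : SmoothFn) :
    η.opA a b (η.christoffel a b U V) = η.partialD (η.bilin a b U V) :=
  η.opA_opAInv ha hb _

theorem hasVelocity_christoffel (ha : 0 < a) (hb : 0 < b) (U V W : SmoothFn) :
    HasVelocity (fun t : ℝ => (η.translate (t • U)).christoffel a b V W)
      (η.christoffelDeriv a b U V W) := by
  have h1 := (hasVelocity_const (a • (V * W))).add
    ((hasVelocity_mul (hasVelocity_partialD_const η V U)
      (hasVelocity_partialD_const η W U)).const_smul (b / 2))
  simp only [zero_smul, translate_zero] at h1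
  have h2 := hasVelocity_opAInv (η := η) ha hb (hasVelocity_partialD (η := η) h1 U) U
  simp only [zero_smul, translate_zero] at h2
  have h3 : (0 : SmoothFn) + (b / 2) • (-(η.partialD U * η.partialD V) * η.partialD W +
      η.partialD V * -(η.partialD U * η.partialD W)) =
      -(b • (η.partialD U * η.partialD V * η.partialD W)) := SmoothFn.ext fun x => by
    simp only [add_apply, zero_apply, smul_apply, neg_apply, SmoothFn.mul_apply]
    ring
  rw [h3] at h2
  exact h2

theorem _root_.CircleGeometry.abMetric_comm (a b : ℝ) (U V : SmoothFn) :
    abMetric a b η U V = abMetric a b η V U := by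
  rw [abMetric_eq, abMetric_eq, mul_comm U, mul_comm (η.partialD U)]

theorem _root_.CircleGeometry.abMetric_eq_integral_opA_mul (a b : ℝ) (U V : SmoothFn) :
    abMetric a b η U V = η.integral (η.opA a b U * V) := by
  rw [abMetric_eq]
  refine η.integral_eq_of_sub_eq (h := b • (η.partialD U * V)) (SmoothFn.ext fun x => ?_)
  simp only [opA_apply, partialD_smul, partialD_mul, sub_apply, add_apply, smul_apply,
    SmoothFn.mul_apply]
  ring

theorem isLeviCivita_christoffel (ha : 0 < a) (hb : 0 < b) :
    IsLeviCivita translate (abMetric a b) fun η => η.christoffel a b := by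
  refine ⟨fun η U V => η.christoffel_comm a b U V, fun η U V W => ?_⟩
  have h1 := (hasVelocity_const (a • (V * W))).add
    ((hasVelocity_mul (hasVelocity_partialD_const η V U)
      (hasVelocity_partialD_const η W U)).const_smul b)
  have h2 := hasDerivAt_integral (η := η) h1 U
  simp only [zero_smul, translate_zero] at h2
  simp only [abMetric_eq _ _ _ V W]
  refine h2.congr_deriv ?_
  -- Written as `∫ (A U) V`, the metric cancels the `A⁻¹` in the Christoffel map, and a local
  -- identity remains.
  rw [abMetric_eq_integral_opA_mul, abMetric_comm, abMetric_eq_integral_opA_mul,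
    opA_christoffel η ha hb, opA_christoffel η ha hb, ← map_add]
  refine η.integral_eq_of_sub_eq
    (h := -(η.bilin a b U V * W + η.bilin a b U W * V - a • (U * V * W)))
    (SmoothFn.ext fun x => ?_)
  simp only [bilin_apply, partialD_neg, partialD_sub, partialD_add, partialD_smul, partialD_mul,
    sub_apply, add_apply, smul_apply, neg_apply, SmoothFn.mul_apply, zero_apply]
  ring

theorem hasCurvatureAt (ha : 0 < a) (hb : 0 < b) (U V W : SmoothFn) :
    HasCurvatureAt translate (fun η => η.christoffel a b) η U V W (η.curvature a b U V W) :=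
  ⟨_, _, η.hasVelocity_christoffel ha hb U V W, η.hasVelocity_christoffel ha hb V U W, rfl⟩

/-- Pairing with the metric cancels the outer `A⁻¹`. The first term on the right is symmetric in all
four vectors, so it drops out of the curvature. -/
theorem abMetric_christoffelDeriv_add (ha : 0 < a) (hb : 0 < b) (U V W X : SmoothFn) :
    abMetric a b η (η.christoffelDeriv a b U V W + η.christoffel a b U (η.christoffel a b V W)) X =
      η.integral (b • (η.partialD U * η.partialD V * (η.partialD W * η.partialD X))) -
        abMetric a b η (η.christoffel a b V W) (η.christoffel a b U X) := by
  rw [abMetric_eq_integral_opA_mul, abMetric_comm _ _ _ (η.christoffel a b V W),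
    abMetric_eq_integral_opA_mul, map_add, opA_christoffel η ha hb, opA_christoffel η ha hb,
    christoffelDeriv, opA_opAInv η ha hb, ← opA_christoffel η ha hb V W, ← map_sub]
  -- Once `∂B(V, W)` is replaced by `A g`, the identity holds for every `g`.
  generalize η.christoffel a b V W = g
  refine η.integral_eq_of_sub_eq
    (h := -(b • (η.partialD U * η.partialD V * η.partialD W)) * X -
      (b / 2) • (η.partialD U * η.partialD g * X) + g * η.bilin a b U X)
    (SmoothFn.ext fun x => ?_)
  simp only [bilin_apply, opA_apply, partialD_neg, partialD_sub, partialD_add, partialD_smul,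
    partialD_mul, sub_apply, add_apply, smul_apply, neg_apply, SmoothFn.mul_apply]
  ring

theorem abMetric_curvature (ha : 0 < a) (hb : 0 < b) (U V : SmoothFn) :
    abMetric a b η (η.curvature a b U V V) U =
      abMetric a b η (η.christoffel a b U V) (η.christoffel a b U V) -
        abMetric a b η (η.christoffel a b U U) (η.christoffel a b V V) := by
  have hsub : ∀ X Y Z : SmoothFn,
      abMetric a b η (X - Y) Z = abMetric a b η X Z - abMetric a b η Y Z := fun X Y Z => by
    simp only [abMetric_eq_integral_opA_mul, map_sub, sub_mul]
  rw [curvature, hsub, abMetric_christoffelDeriv_add η ha hb, abMetric_christoffelDeriv_add η ha hb,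
    η.christoffel_comm a b V U, abMetric_comm η a b (η.christoffel a b V V),
    mul_comm (η.partialD V) (η.partialD U)]
  ring

end DiffS1

/-! ## The Levi-Civita connection and the curvature of the semidirect product -/

namespace SemiDiff

variable (p : SemiDiff)

/-- The Christoffel map of the metric `semiMetric a b`. -/
noncomputable def christoffel (a b : ℝ) (p : SemiDiff) :
    SmoothFn × SmoothFn →ₗ[ℝ] SmoothFn × SmoothFn →ₗ[ℝ] SmoothFn × SmoothFn :=
  LinearMap.mk₂ ℝ
    (fun X Y => (p.diffeo.partialD (X.1 * Y.1 + (b / (2 * a)) • (X.2 * Y.2)),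
      (1 / 2 : ℝ) • (Y.2 * p.diffeo.partialD X.1 + X.2 * p.diffeo.partialD Y.1)))
    (fun X X' Y => by
      refine Prod.ext (SmoothFn.ext fun x => ?_) (SmoothFn.ext fun x => ?_) <;>
      simp only [Prod.fst_add, Prod.snd_add, DiffS1.partialD_add, DiffS1.partialD_smul,
        DiffS1.partialD_mul, add_apply, smul_apply, SmoothFn.mul_apply] <;> ring)
    (fun c X Y => by
      refine Prod.ext (SmoothFn.ext fun x => ?_) (SmoothFn.ext fun x => ?_) <;>
      simp only [Prod.smul_fst, Prod.smul_snd, DiffS1.partialD_add, DiffS1.partialD_smul,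
        DiffS1.partialD_mul, add_apply, smul_apply, SmoothFn.mul_apply] <;> ring)
    (fun X Y Y' => by
      refine Prod.ext (SmoothFn.ext fun x => ?_) (SmoothFn.ext fun x => ?_) <;>
      simp only [Prod.fst_add, Prod.snd_add, DiffS1.partialD_add, DiffS1.partialD_smul,
        DiffS1.partialD_mul, add_apply, smul_apply, SmoothFn.mul_apply] <;> ring)
    (fun c X Y => by
      refine Prod.ext (SmoothFn.ext fun x => ?_) (SmoothFn.ext fun x => ?_) <;>
      simp only [Prod.smul_fst, Prod.smul_snd, DiffS1.partialD_add, DiffS1.partialD_smul,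
        DiffS1.partialD_mul, add_apply, smul_apply, SmoothFn.mul_apply] <;> ring)

theorem christoffel_apply (a b : ℝ) (X Y : SmoothFn × SmoothFn) :
    p.christoffel a b X Y = (p.diffeo.partialD (X.1 * Y.1 + (b / (2 * a)) • (X.2 * Y.2)),
      (1 / 2 : ℝ) • (Y.2 * p.diffeo.partialD X.1 + X.2 * p.diffeo.partialD Y.1)) := rfl

theorem christoffel_comm (a b : ℝ) (X Y : SmoothFn × SmoothFn) :
    p.christoffel a b X Y = p.christoffel a b Y X := by
  rw [christoffel_apply, christoffel_apply, mul_comm X.1, mul_comm X.2, add_comm (_ * _) (_ * _)]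

/-- The curvature tensor of the metric `semiMetric a b`. -/
noncomputable def curvature (a b : ℝ) (X Y Z : SmoothFn × SmoothFn) : SmoothFn × SmoothFn :=
  ((-(p.diffeo.partialD X.1 * (p.christoffel a b Y Z).1),
      -(p.diffeo.partialD X.1 * (p.christoffel a b Y Z).2)) +
    p.christoffel a b X (p.christoffel a b Y Z)) -
  ((-(p.diffeo.partialD Y.1 * (p.christoffel a b X Z).1),
      -(p.diffeo.partialD Y.1 * (p.christoffel a b X Z).2)) +
    p.christoffel a b Y (p.christoffel a b X Z))

theorem hasVelocity_christoffel (a b : ℝ) (X Y Z : SmoothFn × SmoothFn) :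
    HasVelocity (fun t : ℝ => (p.translate (t • X)).christoffel a b Y Z)
      (-(p.diffeo.partialD X.1 * (p.christoffel a b Y Z).1),
        -(p.diffeo.partialD X.1 * (p.christoffel a b Y Z).2)) := by
  have h1 := DiffS1.hasVelocity_partialD_const p.diffeo (Y.1 * Z.1 + (b / (2 * a)) • (Y.2 * Z.2)) X.1
  have h2 := ((hasVelocity_mul (hasVelocity_const Z.2)
      (DiffS1.hasVelocity_partialD_const p.diffeo Y.1 X.1)).add
    (hasVelocity_mul (hasVelocity_const Y.2)
      (DiffS1.hasVelocity_partialD_const p.diffeo Z.1 X.1))).const_smul (1 / 2)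
  have h3 : -(p.diffeo.partialD X.1 * (p.christoffel a b Y Z).2) =
      (1 / 2 : ℝ) • (0 * (p.diffeo.translate ((0 : ℝ) • X.1)).partialD Y.1 +
        Z.2 * -(p.diffeo.partialD X.1 * p.diffeo.partialD Y.1) +
        (0 * (p.diffeo.translate ((0 : ℝ) • X.1)).partialD Z.1 +
          Y.2 * -(p.diffeo.partialD X.1 * p.diffeo.partialD Z.1))) := by
    rw [christoffel_apply, mul_smul_comm, ← smul_neg]
    congr 1
    ring
  rw [h3]
  exact h1.prodMk h2

theorem hasCurvatureAt (a b : ℝ) (X Y Z : SmoothFn × SmoothFn) :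
    HasCurvatureAt translate (christoffel a b) p X Y Z (p.curvature a b X Y Z) :=
  ⟨_, _, p.hasVelocity_christoffel a b X Y Z, p.hasVelocity_christoffel a b Y X Z, rfl⟩

variable {a b : ℝ}

theorem isLeviCivita_christoffel (ha : 0 < a) :
    IsLeviCivita translate (semiMetric a b) (christoffel a b) := by
  refine ⟨fun p => p.christoffel_comm a b, fun p X Y Z => ?_⟩
  have h1 := DiffS1.hasDerivAt_integral (η := p.diffeo)
    (hasVelocity_const (a • (Y.1 * Z.1) + b • (Y.2 * Z.2))) X.1
  simp only [semiMetric_eq]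
  refine h1.congr_deriv ?_
  rw [← map_add]
  refine p.diffeo.integral_eq_of_sub_eq
    (h := -(a • (X.1 * Y.1 * Z.1) + (b / 2) • (X.2 * (Y.2 * Z.1 + Z.2 * Y.1))))
    (SmoothFn.ext fun x => ?_)
  simp only [christoffel_apply, DiffS1.partialD_neg, DiffS1.partialD_add, DiffS1.partialD_smul,
    DiffS1.partialD_mul, sub_apply, add_apply, smul_apply, neg_apply, SmoothFn.mul_apply,
    zero_apply]
  field_simp
  ring

/-- The vector `G` stands for `Γ(Y, Z)`, whose velocity along `X` is `-∂X.1` times itself. Here no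
symmetric remainder appears, and the curvature is at once quadratic in `Γ`. -/
theorem semiMetric_neg_mul_christoffel_add (ha : 0 < a) (X G T : SmoothFn × SmoothFn) :
    semiMetric a b p ((-(p.diffeo.partialD X.1 * G.1), -(p.diffeo.partialD X.1 * G.2)) +
      p.christoffel a b X G) T = -semiMetric a b p G (p.christoffel a b X T) := by
  simp only [semiMetric_eq]
  rw [← map_neg]
  refine p.diffeo.integral_eq_of_sub_eq
    (h := a • (G.1 * X.1 * T.1) + (b / 2) • (G.1 * X.2 * T.2 + T.1 * X.2 * G.2))
    (SmoothFn.ext fun x => ?_)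
  simp only [christoffel_apply, DiffS1.partialD_add, DiffS1.partialD_smul,
    DiffS1.partialD_mul, sub_apply, add_apply, smul_apply, neg_apply, SmoothFn.mul_apply,
    Prod.fst_add, Prod.snd_add]
  field_simp
  ring

theorem semiMetric_curvature (ha : 0 < a) (X Y : SmoothFn × SmoothFn) :
    semiMetric a b p (p.curvature a b X Y Y) X =
      semiMetric a b p (p.christoffel a b X Y) (p.christoffel a b X Y) -
        semiMetric a b p (p.christoffel a b Y Y) (p.christoffel a b X X) := by
  have hsub : ∀ X Y Z : SmoothFn × SmoothFn,
      semiMetric a b p (X - Y) Z = semiMetric a b p X Z - semiMetric a b p Y Z := fun X Y Z => by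
    simp only [semiMetric_eq, ← map_sub, Prod.fst_sub, Prod.snd_sub, sub_mul, smul_sub]
    congr 1
    abel
  rw [curvature, hsub, semiMetric_neg_mul_christoffel_add p ha,
    semiMetric_neg_mul_christoffel_add p ha, p.christoffel_comm a b Y X]
  ring

end SemiDiff

/-! ## The second fundamental form -/

namespace DiffS1

variable (η : DiffS1) {a b : ℝ}

/-- The normal vector `-((b / a) ∂² f, ∂ f)` along `Υ`, where `∂ f = f_x / η_x`. -/
noncomputable def normal (a b : ℝ) (f : SmoothFn) : SmoothFn × SmoothFn :=
  ((b / a) • η.partialD (-η.partialD f), -η.partialD f)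

/-- The second fundamental form of `Υ`. -/
noncomputable def secondForm (a b : ℝ) (U V : SmoothFn) : SmoothFn × SmoothFn :=
  η.normal a b (η.christoffel a b U V)

theorem semiMetric_normal (ha : 0 < a) (f W : SmoothFn) :
    semiMetric a b (Upsilon η) (η.normal a b f) (η.tangentUpsilon W) = 0 := by
  rw [semiMetric_eq]
  refine Eq.trans (congrArg η.integral ?_) (η.integral_partialD (-(b • (η.partialD f * W))))
  refine SmoothFn.ext fun x => ?_
  simp only [normal, tangentUpsilon_apply, partialD_neg, partialD_smul, partialD_mul, add_apply,
    smul_apply, neg_apply, SmoothFn.mul_apply]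
  field_simp
  ring

/-- The ambient derivative of the field `DΥ(V)` along `DΥ(U)` is
`(∂(a U V + (b/2) ∂U ∂V) / a, 0)`. -/
theorem christoffel_tangentUpsilon (ha : 0 < a) (U V : SmoothFn) :
    (Upsilon η).christoffel a b (η.tangentUpsilon U) (η.tangentUpsilon V) =
      ((1 / a) • η.partialD (η.bilin a b U V), η.partialD U * η.partialD V) := by
  rw [SemiDiff.christoffel_apply]
  refine Prod.ext (SmoothFn.ext fun x => ?_) (SmoothFn.ext fun x => ?_)
  · change η.partialD (U * V + (b / (2 * a)) • (η.partialD U * η.partialD V)) x = _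
    simp only [bilin_apply, partialD_add, partialD_smul, add_apply, smul_apply]
    field_simp
  · change (1 / 2) * ((η.partialD V * η.partialD U) x + (η.partialD U * η.partialD V) x) = _
    simp only [SmoothFn.mul_apply]
    ring

/-- The velocity `(0, -∂U ∂V)` of `DΥ V` cancels the second component of the ambient Christoffel
term. What is left is `((1/a) A g, 0)`, minus the tangential part `(g, ∂g)`. -/
theorem hasSecondFundamentalFormAt (ha : 0 < a) (hb : 0 < b) (U V : SmoothFn) :
    HasSecondFundamentalFormAt translate Upsilon tangentUpsilon (fun η => η.christoffel a b)
      (SemiDiff.christoffel a b) η U V (η.secondForm a b U V) := by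
  refine ⟨_, (hasVelocity_const V).prodMk (hasVelocity_partialD_const η V U), ?_⟩
  rw [christoffel_tangentUpsilon η ha, ← opA_christoffel η ha hb, secondForm]
  generalize η.christoffel a b U V = g
  refine Prod.ext (SmoothFn.ext fun x => ?_) (SmoothFn.ext fun x => ?_)
  · simp only [normal, tangentUpsilon_apply, opA_apply, partialD_neg, Prod.fst_add, Prod.fst_sub,
      sub_apply, add_apply, smul_apply, neg_apply, zero_apply]
    field_simp
    ring
  · simp only [normal, tangentUpsilon_apply, Prod.snd_add, Prod.snd_sub, sub_apply, add_apply,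
      neg_apply]
    ring

/-- Since `A` commutes with `∂`, `A⁻¹ ∂` may be read as `∂ A⁻¹`, which is the form in which `Q` is
written. -/
theorem christoffel_comp (ha : 0 < a) (hb : 0 < b) (u v : SmoothFn) :
    η.christoffel a b (u.comp η) (v.comp η) =
      (opAinv a b (a • (u * v) + (b / 2) • (u.D * v.D))).D.comp η := by
  refine η.opAInv_eq ha hb ?_
  rw [← partialD_comp, opA_partialD]
  refine congrArg η.partialD ?_
  rw [opA_comp, opA_opAinv ha hb, bilin_apply, partialD_comp, partialD_comp]
  rfl

theorem secondForm_comp (ha : 0 < a) (hb : 0 < b) (u v : SmoothFn) :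
    η.secondForm a b (u.comp η) (v.comp η) =
      ((b / a) • (opQ a b u v).D.comp η, (opQ a b u v).comp η) := by
  rw [secondForm, normal, christoffel_comp η ha hb, partialD_comp, ← neg_comp, partialD_comp]
  rfl

/-- The metric of the tangential and normal components of an ambient derivative. -/
theorem integral_opA_mul_opA (ha : 0 < a) (f g : SmoothFn) :
    η.integral ((1 / a) • (η.opA a b f * η.opA a b g)) =
      abMetric a b η f g + semiMetric a b (Upsilon η) (η.normal a b f) (η.normal a b g) := by
  rw [abMetric_eq, semiMetric_eq]
  change _ = η.integral _ + η.integral _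
  rw [← map_add]
  -- `((1/a) A f, 0)` is the sum of `(f, ∂f)` and `normal f`; the cross terms of the two orthogonal
  -- parts make up the exact term.
  refine η.integral_eq_of_sub_eq (h := -(b • (f * η.partialD g + g * η.partialD f)))
    (SmoothFn.ext fun x => ?_)
  simp only [normal, opA_apply, partialD_neg, partialD_smul, partialD_add, partialD_mul, sub_apply,
    add_apply, smul_apply, neg_apply, SmoothFn.mul_apply]
  field_simp
  ring

/-- Only first components contribute: the second components `∂U ∂V` give `(∂U ∂V)²` in both
products, and these cancel. -/
theorem semiMetric_curvature_tangentUpsilon (ha : 0 < a) (U V : SmoothFn) :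
    semiMetric a b (Upsilon η) ((Upsilon η).curvature a b (η.tangentUpsilon U)
        (η.tangentUpsilon V) (η.tangentUpsilon V)) (η.tangentUpsilon U) =
      η.integral ((1 / a) • (η.partialD (η.bilin a b U V) * η.partialD (η.bilin a b U V))) -
        η.integral ((1 / a) • (η.partialD (η.bilin a b U U) * η.partialD (η.bilin a b V V))) := by
  rw [SemiDiff.semiMetric_curvature _ ha, christoffel_tangentUpsilon η ha,
    christoffel_tangentUpsilon η ha, christoffel_tangentUpsilon η ha, semiMetric_eq, semiMetric_eq,
    ← map_sub, ← map_sub]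
  refine congrArg η.integral (SmoothFn.ext fun x => ?_)
  simp only [sub_apply, add_apply, smul_apply, SmoothFn.mul_apply]
  field_simp
  ring

/-- With `∂B = A Γ`, Pythagoras splits each ambient product into the product of two `Γ`'s, which
form the intrinsic curvature, and the product of two values of `Π`. -/
theorem gauss_codazzi (ha : 0 < a) (hb : 0 < b) (U V : SmoothFn) :
    abMetric a b η (η.curvature a b U V V) U =
      semiMetric a b (Upsilon η) ((Upsilon η).curvature a b (η.tangentUpsilon U)
        (η.tangentUpsilon V) (η.tangentUpsilon V)) (η.tangentUpsilon U) +
      semiMetric a b (Upsilon η) (η.secondForm a b U U) (η.secondForm a b V V) -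
      semiMetric a b (Upsilon η) (η.secondForm a b U V) (η.secondForm a b U V) := by
  rw [semiMetric_curvature_tangentUpsilon η ha, abMetric_curvature η ha hb]
  simp only [← opA_christoffel η ha hb, integral_opA_mul_opA η ha, secondForm]
  ring

theorem semiMetric_curvature_comp (ha : 0 < a) (u v : SmoothFn) :
    semiMetric a b (Upsilon η) ((Upsilon η).curvature a b (η.tangentUpsilon (u.comp η))
        (η.tangentUpsilon (v.comp η)) (η.tangentUpsilon (v.comp η)))
        (η.tangentUpsilon (u.comp η)) =
      (1 / a) * integralS1 ((a • (u * v.D - v * u.D) +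
        (b / 2) • (v.D * u.D.D - u.D * v.D.D)) ^ 2) := by
  rw [semiMetric_curvature_tangentUpsilon η ha, ← map_sub, ← integral_comp η]
  change _ = (1 / a) • η.integral _
  rw [← map_smul]
  -- This is `(X + Y)² - 4 X Y = (X - Y)²` with `X = (a u + (b/2) u_xx) v_x` and `Y = (a v + (b/2)
  -- v_xx) u_x`: `∂B(u, v)` is `X + Y`, while `∂B(u, u) ∂B(v, v)` is `4 X Y`.
  refine congrArg η.integral (SmoothFn.ext fun x => ?_)
  simp only [bilin_apply, partialD_add, partialD_smul, partialD_mul, partialD_comp, sub_apply,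
    add_apply, smul_apply, SmoothFn.mul_apply, comp_apply, pow_apply]
  ring

theorem semiMetric_secondForm_comp (ha : 0 < a) (hb : 0 < b) (u v w z : SmoothFn) :
    semiMetric a b (Upsilon η) (η.secondForm a b (u.comp η) (v.comp η))
        (η.secondForm a b (w.comp η) (z.comp η)) =
      (b / a) * innerH1 a b (opQ a b u v) (opQ a b w z) := by
  rw [secondForm_comp η ha hb, secondForm_comp η ha hb, semiMetric_eq, innerH1,
    ← integral_comp η]
  change _ = (b / a) • η.integral _
  rw [← map_smul]
  refine congrArg η.integral (SmoothFn.ext fun x => ?_)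
  simp only [add_apply, smul_apply, SmoothFn.mul_apply, comp_apply]
  field_simp
  ring

end DiffS1

end CircleGeometry

/-! ### The theorem -/

theorem theoremA2 (a b : ℝ) (ha : 0 < a) (hb : 0 < b) :
    -- the two metrics are right-invariant
    IsRightInvariant DiffS1.translate (abMetric a b) ∧
    IsRightInvariant SemiDiff.translate (semiMetric a b) ∧
    -- `Υ` is a group homomorphism and a smooth embedding
    (∀ η ξ : DiffS1, Upsilon (η * ξ) = Upsilon η * Upsilon ξ) ∧
    IsSmoothEmbedding DiffS1.translate SemiDiff.translate Upsilon ∧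
    -- its tangent maps, with `DΥ (u) = (u, u_x)` at the identity
    ∃ dΥ : DiffS1 → SmoothFn →L[ℝ] SmoothFn × SmoothFn,
      (∀ η, HasTangentMapAt DiffS1.translate SemiDiff.translate Upsilon η (dΥ η)) ∧
      (∀ (η : DiffS1) (u : SmoothFn), dΥ η (u.comp η) = (u.comp η, u.D.comp η)) ∧
      -- the induced metric is the `a`-`b` metric
      (∀ (η : DiffS1) (U V : SmoothFn),
        semiMetric a b (Upsilon η) (dΥ η U) (dΥ η V) = abMetric a b η U V) ∧
      Function.Bijective (opA a b) ∧
      -- the Levi-Civita connections, their curvature tensors and the second fundamental form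
      ∃ (ΓN : DiffS1 → SmoothFn →ₗ[ℝ] SmoothFn →ₗ[ℝ] SmoothFn)
        (ΓM : SemiDiff → SmoothFn × SmoothFn →ₗ[ℝ] SmoothFn × SmoothFn →ₗ[ℝ]
          SmoothFn × SmoothFn)
        (RN : DiffS1 → SmoothFn → SmoothFn → SmoothFn → SmoothFn)
        (RM : SemiDiff → SmoothFn × SmoothFn → SmoothFn × SmoothFn → SmoothFn × SmoothFn →
          SmoothFn × SmoothFn)
        (II : DiffS1 → SmoothFn → SmoothFn → SmoothFn × SmoothFn),
        IsLeviCivita DiffS1.translate (abMetric a b) ΓN ∧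
        IsLeviCivita SemiDiff.translate (semiMetric a b) ΓM ∧
        (∀ η U V W, HasCurvatureAt DiffS1.translate ΓN η U V W (RN η U V W)) ∧
        (∀ p X Y Z, HasCurvatureAt SemiDiff.translate ΓM p X Y Z (RM p X Y Z)) ∧
        (∀ η U V, HasSecondFundamentalFormAt DiffS1.translate Upsilon dΥ ΓN ΓM η U V
          (II η U V)) ∧
        -- the second fundamental form is normal to the image, and is given by `Q`
        (∀ η U V W, semiMetric a b (Upsilon η) (II η U V) (dΥ η W) = 0) ∧
        (∀ (η : DiffS1) (u v : SmoothFn), II η (u.comp η) (v.comp η) =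
          ((b / a) • (opQ a b u v).D.comp η, (opQ a b u v).comp η)) ∧
        -- the Gauss-Codazzi formula of the embedding
        (∀ η U V, abMetric a b η (RN η U V V) U =
          semiMetric a b (Upsilon η)
            (RM (Upsilon η) (dΥ η U) (dΥ η V) (dΥ η V)) (dΥ η U) +
          semiMetric a b (Upsilon η) (II η U U) (II η V V) -
          semiMetric a b (Upsilon η) (II η U V) (II η U V)) ∧
        -- its three terms are those of the curvature formula
        (∀ (η : DiffS1) (u v : SmoothFn),
          semiMetric a b (Upsilon η) (RM (Upsilon η) (dΥ η (u.comp η)) (dΥ η (v.comp η))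
              (dΥ η (v.comp η))) (dΥ η (u.comp η)) =
            (1 / a) * integralS1 ((a • (u * v.D - v * u.D) +
              (b / 2) • (v.D * u.D.D - u.D * v.D.D)) ^ 2) ∧
          semiMetric a b (Upsilon η) (II η (u.comp η) (u.comp η)) (II η (v.comp η) (v.comp η)) =
            (b / a) * innerH1 a b (opQ a b u u) (opQ a b v v) ∧
          semiMetric a b (Upsilon η) (II η (u.comp η) (v.comp η)) (II η (u.comp η) (v.comp η)) =
            (b / a) * innerH1 a b (opQ a b u v) (opQ a b u v) ∧
          abMetric a b η (RN η (u.comp η) (v.comp η) (v.comp η)) (u.comp η) =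
            (1 / a) * integralS1 ((a • (u * v.D - v * u.D) +
              (b / 2) • (v.D * u.D.D - u.D * v.D.D)) ^ 2) +
            (b / a) * innerH1 a b (opQ a b u u) (opQ a b v v) -
            (b / a) * innerH1 a b (opQ a b u v) (opQ a b u v)) := by
  refine ⟨isRightInvariant_abMetric a b, isRightInvariant_semiMetric a b, Upsilon_mul,
    isSmoothEmbedding_Upsilon, DiffS1.tangentUpsilon, DiffS1.hasTangentMapAt_Upsilon,
    DiffS1.tangentUpsilon_comp, semiMetric_Upsilon a b, bijective_opA ha hb,
    fun η => η.christoffel a b, SemiDiff.christoffel a b, fun η => η.curvature a b,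
    fun p => p.curvature a b, fun η => η.secondForm a b,
    DiffS1.isLeviCivita_christoffel ha hb, SemiDiff.isLeviCivita_christoffel ha,
    fun η => η.hasCurvatureAt ha hb, fun p => p.hasCurvatureAt a b,
    fun η => η.hasSecondFundamentalFormAt ha hb,
    fun η U V W => η.semiMetric_normal ha _ W, fun η => η.secondForm_comp ha hb,
    fun η => η.gauss_codazzi ha hb, fun η u v =>
      ⟨η.semiMetric_curvature_comp ha u v, η.semiMetric_secondForm_comp ha hb u u v v,
        η.semiMetric_secondForm_comp ha hb u v u v, ?_⟩⟩
  rw [← η.semiMetric_curvature_comp ha u v, ← η.semiMetric_secondForm_comp ha hb u u v v,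
    ← η.semiMetric_secondForm_comp ha hb u v u v]
  exact η.gauss_codazzi ha hb _ _
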